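/- Let $\{W(t)\}_{t\in[0,1]}$ be a family of binary memoryless symmetric channels, with input alphabet $\{\pm1\}$ and output alphabet $\overline{\mathbb R}$ (symmetric means that the output law given input $+1$ is the reflection $y\mapsto -y$ of the output law given input $-1$). Assume that the family is ordered by degradation ($W(t)$ is degraded with respect to $W(s)$ for $0\le s\le t\le 1$), that $W(0)$ is perfect (the output determines the input), that $W(1)$ is uninformative (the output is independent of the input), and that the entropy function $\mathcal H(t)=H(X_{\mathrm u}\mid Y_{\mathrm u}(t))$ is absolutely continuous on $[0,1]$, where $X_{\mathrm u}$ is uniform on $\{\pm1\}$ and $Y_{\mathrm u}(t)$ is its observation through $W(t)$. Entropies are measured in bits. Let $X=(X_0,\dots,X_{N-1})$ be a random vector with an arbitrary distribution on $\{\pm1\}^N$. Given $X$, let all observations be conditionally independent, with $Y_i(t)$, and likewise the second look $Y_i'(t)$, an observation of $X_i$ through $W(t)$; write $Y_{\sim i}(t)=(Y_l(t))_{l\ne i}$. For $i\in[N]=\{0,\dots,N-1\}$ and $j\ne i$ define $$G_i(t)=\frac{\partial}{\partial s}H\big(X\mid Y_i(s),Y_{\sim i}(t)\big)\Big|_{s=t},\qquad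 G_i^j(t)=\frac{\partial}{\partial s}H\big(X\mid Y_i(s),Y_{\sim i}(t),Y_j'(t)\big)\Big|_{s=t}.$$ These derivatives exist for almost every $t\in[0,1]$ and define integrable functions on $[0,1]$, and $$\sum_{i,j\in[N]:\,i\ne j}\int_0^1\big(G_i(t)-G_i^j(t)\big)\,dt\le N .$$ Let $\mathcal G$ be the group of permutations $\pi$ of $[N]$ such that $(X_{\pi(0)},\dots,X_{\pi(N-1)})$ has the same distribution as $X$. If $\mathcal G$ is transitive, then $G_i=G_k$ for all $i,k\in[N]$. If $\mathcal G$ is doubly transitive (for all $i\neq j$ and $k\neq l$ in $[N]$ there is $\pi\in\mathcal G$ with $\pi(i)=k$ and $\pi(j)=l$), then $G_i^j=G_k^l$ for all $i\ne j$ and $k\ne l$ in $[N]$, and $$\int_0^1\big(G_i(t)-G_i^j(t)\big)\,dt\le\frac1{N-1}\qquad\text{for all } i\neq j \text{ in } [N].$$ -/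

import Mathlib

/-- A binary-input symmetric channel with input alphabet `{±1}` (the type `ℤˣ`) and output
alphabet the extended reals: `law x` is the distribution of the output when the input is `x`,
and the law given `+1` is the reflection of the law given `-1`. -/
structure BMSChannel where
  law : ℤˣ → MeasureTheory.Measure EReal
  isProb : ∀ x, MeasureTheory.IsProbabilityMeasure (law x)
  symm : law 1 = (law (-1)).map (fun y => -y)

namespace BMSChannel

/-- The output determines the input: a measurable decoder recovers the input almost surely. -/
def IsPerfect (W : BMSChannel) : Prop :=
  ∃ φ : EReal → ℤˣ, Measurable φ ∧ ∀ x, ∀ᵐ y ∂(W.law x), φ y = x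

/-- The output is independent of the input. -/
def IsUninformative (W : BMSChannel) : Prop :=
  W.law 1 = W.law (-1)

/-- `V` is (stochastically) degraded with respect to `W`: the output of `V` is obtained by
passing the output of `W` through a third channel, which does not depend on the input. -/
def IsDegradedOf (V W : BMSChannel) : Prop :=
  ∃ K : ProbabilityTheory.Kernel EReal EReal, ProbabilityTheory.IsMarkovKernel K ∧
    ∀ x, V.law x = (W.law x).bind K

end BMSChannel

section Entropy

variable {A Y : Type*} [Fintype A] [MeasurableSpace Y]

/-- The law of an observation `Y` when the input has distribution `p` and, given the input `a`,
`Y` has law `κ a`. -/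
noncomputable def outputLaw (p : PMF A) (κ : A → MeasureTheory.Measure Y) :
    MeasureTheory.Measure Y :=
  ∑ a, p a • κ a

/-- The posterior probability `P(X = a | Y = y)`: the density of the measure
`B ↦ P(X = a, Y ∈ B)` with respect to the law of `Y`. -/
noncomputable def posteriorProb (p : PMF A) (κ : A → MeasureTheory.Measure Y) (a : A) (y : Y) : ℝ :=
  ((p a • κ a).rnDeriv (outputLaw p κ) y).toReal

/-- The conditional entropy `H(X | Y)` in bits, where `X` has distribution `p` and, given
`X = a`, `Y` has law `κ a`. -/
noncomputable def condEntropy (p : PMF A) (κ : A → MeasureTheory.Measure Y) : ℝ :=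
  ∫ y, ∑ a, Real.negMulLog (posteriorProb p κ a y) / Real.log 2 ∂(outputLaw p κ)

end Entropy

/-- The entropy function `H(X_u | Y_u(t))` of a channel family, for a uniform input bit. -/
noncomputable def channelEntropy (W : ℝ → BMSChannel) (t : ℝ) : ℝ :=
  condEntropy (PMF.uniformOfFintype ℤˣ) (W t).law

/-- A family `W(t)`, `t ∈ [0,1]`, of BMS channels, ordered by degradation, from the perfect
channel at `t = 0` to the uninformative channel at `t = 1`, with absolutely continuous entropy
function. (The values of `W` outside `[0,1]` play no role.) -/
structure IsACDegradedFamily (W : ℝ → BMSChannel) : Prop where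
  degraded : ∀ s t : ℝ, 0 ≤ s → s ≤ t → t ≤ 1 → (W t).IsDegradedOf (W s)
  perfect : (W 0).IsPerfect
  uninformative : (W 1).IsUninformative
  absolutelyContinuous : AbsolutelyContinuousOnInterval (channelEntropy W) 0 1

section GEXIT

variable {N : ℕ} {ι : Type*} [Fintype ι] [DecidableEq ι]

/-- The conditional law, given the input vector `x`, of conditionally independent observations
indexed by `ι`: observation `k` looks at the coordinate `x (σ k)` through the channel
`W (τ k)`. -/
noncomputable def observationLaw (W : ℝ → BMSChannel) (σ : ι → Fin N) (τ : ι → ℝ)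
    (x : Fin N → ℤˣ) : MeasureTheory.Measure (ι → EReal) :=
  MeasureTheory.Measure.pi fun k => (W (τ k)).law (x (σ k))

/-- The conditional entropy of the input vector given these observations, when observation `k`
has channel parameter `s` and all the others have parameter `t`. -/
noncomputable def perturbedEntropy (p : PMF (Fin N → ℤˣ)) (W : ℝ → BMSChannel) (σ : ι → Fin N)
    (k : ι) (t s : ℝ) : ℝ :=
  condEntropy p (observationLaw W σ (Function.update (fun _ => t) k s))

/-- The observation pattern of the augmented channel: every coordinate is looked at once
(`some i` looks at `i`), and the extra observation `none` is a second look at `j`. -/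
def extraLook (j : Fin N) : Option (Fin N) → Fin N
  | none => j
  | some i => i

/-- `H(X | Y_i(s), Y_{∼i}(t))`. -/
noncomputable def entropyAt (p : PMF (Fin N → ℤˣ)) (W : ℝ → BMSChannel) (i : Fin N)
    (t s : ℝ) : ℝ :=
  perturbedEntropy p W id i t s

/-- `H(X | Y_i(s), Y_{∼i}(t), Y'_j(t))`. -/
noncomputable def entropyAtExtra (p : PMF (Fin N → ℤˣ)) (W : ℝ → BMSChannel) (i j : Fin N)
    (t s : ℝ) : ℝ :=
  perturbedEntropy p W (extraLook j) (some i) t s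

/-- The GEXIT function `G_i(t)`; the derivative in `s` is that of a function on `[0,1]`. -/
noncomputable def gexit (p : PMF (Fin N → ℤˣ)) (W : ℝ → BMSChannel) (i : Fin N) (t : ℝ) : ℝ :=
  derivWithin (entropyAt p W i t) (Set.Icc 0 1) t

/-- The augmented GEXIT function `G_i^j(t)`, with a second independent look at coordinate `j`. -/
noncomputable def gexitExtra (p : PMF (Fin N → ℤˣ)) (W : ℝ → BMSChannel) (i j : Fin N)
    (t : ℝ) : ℝ :=
  derivWithin (entropyAtExtra p W i j t) (Set.Icc 0 1) t

/-- The permutations `π` for which `(X_{π(0)}, …, X_{π(N-1)})` has the same distribution as `X`. -/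
def symmetryGroup (p : PMF (Fin N → ℤˣ)) : Set (Equiv.Perm (Fin N)) :=
  {π | p.map (fun x => x ∘ π) = p}

def HasTransitiveSymmetry (p : PMF (Fin N → ℤˣ)) : Prop :=
  ∀ i j : Fin N, ∃ π ∈ symmetryGroup p, π i = j

def HasDoublyTransitiveSymmetry (p : PMF (Fin N → ℤˣ)) : Prop :=
  ∀ i j k l : Fin N, i ≠ j → k ≠ l → ∃ π ∈ symmetryGroup p, π i = k ∧ π j = l

end GEXIT

open MeasureTheory Filter Topology Set ProbabilityTheory
open scoped ENNReal

/-! Replace every channel output by its soft bit `d`, the conditional mean of a uniform input. A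
symmetric channel becomes a law on `[-1,1]` invariant under `d ↦ -d`, with likelihood `1 + x d`
(`BMSChannel.law_eq_withDensity`). Expanding the binary entropy around `1/2`, one further
observation of a bit lowers the conditional entropy by `∑ c_n m_n (1 - M_n)`. Here `m_n` is the
moment of order `2n+2` of the soft bit of the new channel, and `M_n` is the moment of the same order
of the conditional mean of the observed bit given all other observations
(`hasSum_condEntropy_update`). Both moments decrease under degradation, by Jensen's inequality for
even powers. So the increments of the entropy in each single channel parameter are positive
combinations of the increments of the `m_n`, with weights `1 - M_n` in `[0,1]` that are monotone in
the parameters.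

For one uniform bit all `M_n` vanish and `H = 1 - ∑ c_n m_n`. Absolute continuity of `H` passes to
each `m_n` and, all terms being monotone, gives termwise differentiability almost everywhere
(`ae_isTermwiseDifferentiable`). Hence almost everywhere each GEXIT function is `∑ c_n (-m_n') (1 -
M_n)` and lies between `0` and `H'`. The chain rule along the diagonal yields the area theorem
(`sum_integral_partialDeriv`): for any pattern of looks covering all coordinates, the integrals of
the GEXIT functions add up to `H(X)`, since `W(1)` reveals nothing and `W(0)` everything.

Use this without and with a second look at `j`. Let `g_i` and `g_i^j` be the integrals. The two
looks at `j` are exchangeable, so `∑ g_i = H(X) = ∑ g_i^j + g_j^j`, whence `∑_{i ≠ j} (g_i - g_i^j)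
= 2 g_j^j - g_j`. An extra look lowers the weights, so this is at most `g_j ≤ H(1) - H(0) ≤ 1`.
Summing over `j` gives `N`. Under double transitivity the `N - 1` summands for fixed `j` coincide,
which gives the individual bound. -/

/-! ### Comparison of absolute continuity, and a Scheffé lemma for series -/

theorem AbsolutelyContinuousOnInterval.of_dist_le {f g : ℝ → ℝ} {a b C : ℝ}
    (hg : AbsolutelyContinuousOnInterval g a b)
    (h : ∀ x ∈ uIcc a b, ∀ y ∈ uIcc a b, dist (f x) (f y) ≤ C * dist (g x) (g y)) :
    AbsolutelyContinuousOnInterval f a b := by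
  unfold AbsolutelyContinuousOnInterval at hg ⊢
  have h1 := hg.const_mul C
  rw [mul_zero] at h1
  refine squeeze_zero' (Eventually.of_forall fun E => Finset.sum_nonneg fun _ _ => dist_nonneg) ?_ h1
  refine Eventually.filter_mono inf_le_right ?_
  rw [eventually_principal]
  intro E hE
  rw [Finset.mul_sum]
  refine Finset.sum_le_sum fun i hi => ?_
  have := hE.1 i hi
  exact h _ this.1 _ this.2

/-- Scheffé-type convergence of weighted series. -/
theorem tendsto_tsum_mul_of_tendsto_tsum {α : Type*} {l : Filter α} {q w : α → ℕ → ℝ}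
    {q₀ w₀ : ℕ → ℝ} (hq_nonneg : ∀ᶠ x in l, ∀ n, 0 ≤ q x n) (hq_sum : ∀ᶠ x in l, Summable (q x))
    (hq₀_nonneg : ∀ n, 0 ≤ q₀ n) (hq₀_sum : Summable q₀)
    (hq : ∀ n, Tendsto (fun x => q x n) l (𝓝 (q₀ n)))
    (htsum : Tendsto (fun x => ∑' n, q x n) l (𝓝 (∑' n, q₀ n)))
    (hw_mem : ∀ᶠ x in l, ∀ n, w x n ∈ Icc (0 : ℝ) 1) (hw₀_mem : ∀ n, w₀ n ∈ Icc (0 : ℝ) 1)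
    (hw : ∀ n, Tendsto (fun x => w x n) l (𝓝 (w₀ n))) :
    Tendsto (fun x => ∑' n, q x n * w x n) l (𝓝 (∑' n, q₀ n * w₀ n)) := by
  -- The deficit `max (q₀ - q) 0` is dominated by `q₀`, and `|q - q₀| = (q - q₀) + 2 * max (q₀ - q)
  -- 0`. Convergence of the totals therefore gives convergence in `ℓ¹`.
  have hpos : Tendsto (fun x => ∑' n, max (q₀ n - q x n) 0) l (𝓝 0) := by
    have h := tendsto_tsum_of_dominated_convergence (𝓕 := l)
      (f := fun x n => max (q₀ n - q x n) 0) (g := fun _ => (0 : ℝ)) (bound := q₀) hq₀_sum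
      (fun n => by
        have h2 := ((tendsto_const_nhds (x := q₀ n)).sub (hq n)).max
          (tendsto_const_nhds (x := (0 : ℝ)))
        simpa using h2)
      (by
        filter_upwards [hq_nonneg] with x hx n
        rw [Real.norm_of_nonneg (le_max_right _ _)]
        exact max_le (by linarith [hx n]) (hq₀_nonneg n))
    simpa using h
  have hwt : Tendsto (fun x => ∑' n, q₀ n * |w x n - w₀ n|) l (𝓝 0) := by
    have h := tendsto_tsum_of_dominated_convergence (𝓕 := l)
      (f := fun x n => q₀ n * |w x n - w₀ n|) (g := fun _ => (0 : ℝ)) (bound := q₀) hq₀_sum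
      (fun n => by
        have h2 := (((hw n).sub (tendsto_const_nhds (x := w₀ n))).abs).const_mul (q₀ n)
        simpa using h2)
      (by
        filter_upwards [hw_mem] with x hx n
        rw [Real.norm_of_nonneg (mul_nonneg (hq₀_nonneg n) (abs_nonneg _))]
        refine mul_le_of_le_one_right (hq₀_nonneg n) (abs_le.mpr ⟨?_, ?_⟩)
        · linarith [(hx n).1, (hw₀_mem n).2]
        · linarith [(hx n).2, (hw₀_mem n).1])
    simpa using h
  have hbound : Tendsto (fun x => (∑' n, q x n - ∑' n, q₀ n)
      + 2 * ∑' n, max (q₀ n - q x n) 0 + ∑' n, q₀ n * |w x n - w₀ n|) l (𝓝 0) := by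
    have := ((htsum.sub (tendsto_const_nhds (x := ∑' n, q₀ n))).add (hpos.const_mul 2)).add hwt
    simpa using this
  rw [tendsto_iff_dist_tendsto_zero]
  refine squeeze_zero' (Eventually.of_forall fun _ => dist_nonneg) ?_ hbound
  filter_upwards [hq_nonneg, hq_sum, hw_mem] with x hx hs hwx
  have s1 : Summable fun n => q x n * w x n :=
    Summable.of_nonneg_of_le (fun n => mul_nonneg (hx n) (hwx n).1)
      (fun n => mul_le_of_le_one_right (hx n) (hwx n).2) hs
  have s2 : Summable fun n => q₀ n * w₀ n :=
    Summable.of_nonneg_of_le (fun n => mul_nonneg (hq₀_nonneg n) (hw₀_mem n).1)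
      (fun n => mul_le_of_le_one_right (hq₀_nonneg n) (hw₀_mem n).2) hq₀_sum
  have s3 : Summable fun n => max (q₀ n - q x n) 0 :=
    Summable.of_nonneg_of_le (fun n => le_max_right _ _)
      (fun n => max_le (by linarith [hx n]) (hq₀_nonneg n)) hq₀_sum
  have s4 : Summable fun n => q₀ n * |w x n - w₀ n| :=
    Summable.of_nonneg_of_le (fun n => mul_nonneg (hq₀_nonneg n) (abs_nonneg _))
      (fun n => mul_le_of_le_one_right (hq₀_nonneg n) (abs_le.mpr
        ⟨by linarith [(hwx n).1, (hw₀_mem n).2], by linarith [(hwx n).2, (hw₀_mem n).1]⟩)) hq₀_sum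
  rw [Real.dist_eq, ← s1.tsum_sub s2, ← hs.tsum_sub hq₀_sum, ← tsum_mul_left,
    ← (hs.sub hq₀_sum).tsum_add (s3.mul_left 2),
    ← ((hs.sub hq₀_sum).add (s3.mul_left 2)).tsum_add s4]
  have key : ∀ n, |q x n * w x n - q₀ n * w₀ n| ≤
      q x n - q₀ n + 2 * max (q₀ n - q x n) 0 + q₀ n * |w x n - w₀ n| := by
    intro n
    have e : q x n * w x n - q₀ n * w₀ n = (q x n - q₀ n) * w x n + q₀ n * (w x n - w₀ n) := by
      ring
    rw [e]
    refine (abs_add_le _ _).trans (add_le_add ?_ ?_)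
    · rw [abs_mul]
      refine (mul_le_of_le_one_right (abs_nonneg _)
        (abs_le.mpr ⟨by linarith [(hwx n).1], (hwx n).2⟩)).trans ?_
      rcases le_total (q₀ n) (q x n) with h | h
      · rw [abs_of_nonneg (by linarith), max_eq_right (by linarith)]; linarith
      · rw [abs_of_nonpos (by linarith), max_eq_left (by linarith)]; linarith
    · rw [abs_mul, abs_of_nonneg (hq₀_nonneg n)]
  have s5 := ((hs.sub hq₀_sum).add (s3.mul_left 2)).add s4
  have s6 : Summable fun n => |q x n * w x n - q₀ n * w₀ n| :=
    Summable.of_nonneg_of_le (fun _ => abs_nonneg _) key s5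
  exact (norm_tsum_le_tsum_norm (f := fun n => q x n * w x n - q₀ n * w₀ n) s6).trans
    (s6.tsum_le_tsum key s5)

/-! ### Termwise differentiation of a series of monotone functions -/

/-- The function `H` on `[0,1]` is `1` minus a positive combination of antitone functions `m n`
with values in `[0,1]`, and `H` is absolutely continuous. -/
structure IsAntitoneExpansion (c : ℕ → ℝ) (m : ℕ → ℝ → ℝ) (H : ℝ → ℝ) : Prop where
  coeff_pos : ∀ n, 0 < c n
  summable_coeff : Summable c
  mem_unit : ∀ n t, m n t ∈ Icc (0 : ℝ) 1
  antitoneOn : ∀ n, AntitoneOn (m n) (Icc 0 1)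
  eq_one_sub_tsum : ∀ t ∈ Icc (0 : ℝ) 1, H t = 1 - ∑' n, c n * m n t
  absolutelyContinuous : AbsolutelyContinuousOnInterval H 0 1

/-- Points of the open unit interval at which the expansion of `H` can be differentiated termwise. -/
structure IsTermwiseDifferentiable (c : ℕ → ℝ) (m : ℕ → ℝ → ℝ) (H : ℝ → ℝ) (t : ℝ) : Prop where
  mem : t ∈ Ioo (0 : ℝ) 1
  differentiableAt : DifferentiableAt ℝ H t
  differentiableAt_term : ∀ n, DifferentiableAt ℝ (m n) t
  hasSum : HasSum (fun n => c n * -deriv (m n) t) (deriv H t)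

namespace IsAntitoneExpansion

variable {c : ℕ → ℝ} {m : ℕ → ℝ → ℝ} {H : ℝ → ℝ}

theorem summable_term (h : IsAntitoneExpansion c m H) (t : ℝ) : Summable fun n => c n * m n t :=
  Summable.of_nonneg_of_le (fun n => mul_nonneg (h.coeff_pos n).le (h.mem_unit n t).1)
    (fun n => mul_le_of_le_one_right (h.coeff_pos n).le (h.mem_unit n t).2) h.summable_coeff

theorem summable_term_sub (h : IsAntitoneExpansion c m H) (s t : ℝ) :
    Summable fun n => c n * (m n s - m n t) := by
  simpa [mul_sub] using (h.summable_term s).sub (h.summable_term t)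

theorem sub_eq_tsum (h : IsAntitoneExpansion c m H) {s t : ℝ} (hs : s ∈ Icc (0 : ℝ) 1)
    (ht : t ∈ Icc (0 : ℝ) 1) : H t - H s = ∑' n, c n * (m n s - m n t) := by
  rw [h.eq_one_sub_tsum t ht, h.eq_one_sub_tsum s hs]
  simp_rw [mul_sub]
  rw [(h.summable_term s).tsum_sub (h.summable_term t)]
  ring

theorem term_sub_nonneg (h : IsAntitoneExpansion c m H) {s t : ℝ} (hs : s ∈ Icc (0 : ℝ) 1)
    (ht : t ∈ Icc (0 : ℝ) 1) (hst : s ≤ t) (n : ℕ) : 0 ≤ c n * (m n s - m n t) :=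
  mul_nonneg (h.coeff_pos n).le (sub_nonneg.mpr (h.antitoneOn n hs ht hst))

theorem monotoneOn (h : IsAntitoneExpansion c m H) : MonotoneOn H (Icc 0 1) := by
  intro s hs t ht hst
  rw [← sub_nonneg, h.sub_eq_tsum hs ht]
  exact tsum_nonneg (h.term_sub_nonneg hs ht hst)

theorem sum_term_sub_le (h : IsAntitoneExpansion c m H) {s t : ℝ} (hs : s ∈ Icc (0 : ℝ) 1)
    (ht : t ∈ Icc (0 : ℝ) 1) (hst : s ≤ t) (F : Finset ℕ) :
    ∑ n ∈ F, c n * (m n s - m n t) ≤ H t - H s := by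
  rw [h.sub_eq_tsum hs ht]
  exact (h.summable_term_sub s t).sum_le_tsum F fun n _ => h.term_sub_nonneg hs ht hst n

/-- A single nonnegative term of an increment is at most the whole increment, so `m n` moves at most
`(c n)⁻¹` times as far as `H`. -/
theorem absolutelyContinuous_term (h : IsAntitoneExpansion c m H) (n : ℕ) :
    AbsolutelyContinuousOnInterval (m n) 0 1 := by
  refine h.absolutelyContinuous.of_dist_le (C := (c n)⁻¹) ?_
  rw [uIcc_of_le zero_le_one]
  have key : ∀ x ∈ Icc (0 : ℝ) 1, ∀ y ∈ Icc (0 : ℝ) 1, x ≤ y →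
      dist (m n x) (m n y) ≤ (c n)⁻¹ * dist (H x) (H y) := by
    intro x hx y hy hxy
    have h1 := h.sum_term_sub_le hx hy hxy {n}
    rw [Finset.sum_singleton] at h1
    rw [Real.dist_eq, Real.dist_eq, abs_of_nonneg (sub_nonneg.mpr (h.antitoneOn n hx hy hxy)),
      abs_of_nonpos (sub_nonpos.mpr (h.monotoneOn hx hy hxy)),
      le_inv_mul_iff₀ (h.coeff_pos n)]
    linarith
  intro x hx y hy
  rcases le_total x y with hxy | hxy
  · exact key x hx y hy hxy
  · rw [dist_comm (m n x), dist_comm (H x)]; exact key y hy x hx hxy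

theorem neg_slope_nonneg (h : IsAntitoneExpansion c m H) {t x : ℝ} (ht : t ∈ Icc (0 : ℝ) 1)
    (hx : x ∈ Icc (0 : ℝ) 1) (n : ℕ) : 0 ≤ c n * -slope (m n) t x := by
  refine mul_nonneg (h.coeff_pos n).le ?_
  rw [slope_def_field, ← neg_div]
  rcases le_total t x with htx | hxt
  · exact div_nonneg (by linarith [h.antitoneOn n ht hx htx]) (by linarith)
  · exact div_nonneg_of_nonpos (by linarith [h.antitoneOn n hx ht hxt]) (by linarith)

theorem hasSum_neg_slope (h : IsAntitoneExpansion c m H) {t x : ℝ} (ht : t ∈ Icc (0 : ℝ) 1)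
    (hx : x ∈ Icc (0 : ℝ) 1) : HasSum (fun n => c n * -slope (m n) t x) (slope H t x) := by
  have h1 := ((h.summable_term_sub t x).hasSum).div_const (x - t)
  rw [← h.sub_eq_tsum ht hx] at h1
  rw [slope_def_field]
  refine h1.congr_fun fun n => ?_
  rw [slope_def_field]; ring

theorem tendsto_neg_slope {t : ℝ} {n : ℕ} (hm : DifferentiableAt ℝ (m n) t) :
    Tendsto (fun x => c n * -slope (m n) t x) (𝓝[≠] t) (𝓝 (c n * -deriv (m n) t)) :=
  ((hasDerivAt_iff_tendsto_slope.mp hm.hasDerivAt).neg).const_mul (c n)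

theorem eventually_mem_Icc {t : ℝ} (ht : t ∈ Ioo (0 : ℝ) 1) :
    ∀ᶠ x in 𝓝[≠] t, x ∈ Icc (0 : ℝ) 1 :=
  eventually_nhdsWithin_of_eventually_nhds (Icc_mem_nhds ht.1 ht.2)

theorem neg_deriv_nonneg (h : IsAntitoneExpansion c m H) {t : ℝ} (ht : t ∈ Ioo (0 : ℝ) 1) {n : ℕ}
    (hm : DifferentiableAt ℝ (m n) t) : 0 ≤ c n * -deriv (m n) t :=
  ge_of_tendsto (tendsto_neg_slope hm) <| (eventually_mem_Icc ht).mono fun _ hx =>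
    h.neg_slope_nonneg (Ioo_subset_Icc_self ht) hx n

/-- Finite partial sums of the nonnegative difference quotients stay below the quotient of `H`; pass
to the limit. This is the easy half of termwise differentiation. -/
theorem sum_neg_deriv_le (h : IsAntitoneExpansion c m H) {t : ℝ} (ht : t ∈ Ioo (0 : ℝ) 1)
    (hH : DifferentiableAt ℝ H t) (hm : ∀ n, DifferentiableAt ℝ (m n) t) (F : Finset ℕ) :
    ∑ n ∈ F, c n * -deriv (m n) t ≤ deriv H t := by
  refine le_of_tendsto_of_tendsto (tendsto_finsetSum F fun n _ => tendsto_neg_slope (hm n))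
    (hasDerivAt_iff_tendsto_slope.mp hH.hasDerivAt) ?_
  filter_upwards [eventually_mem_Icc ht] with x hx
  have ht' := Ioo_subset_Icc_self ht
  exact sum_le_hasSum F (fun n _ => h.neg_slope_nonneg ht' hx n) (h.hasSum_neg_slope ht' hx)

theorem ae_mem_Ioo : ∀ᵐ t : ℝ, t ∈ Icc (0 : ℝ) 1 → t ∈ Ioo (0 : ℝ) 1 := by
  have h0 : ∀ᵐ t : ℝ, t ≠ 0 := by simp [ae_iff, measure_singleton]
  have h1 : ∀ᵐ t : ℝ, t ≠ 1 := by simp [ae_iff, measure_singleton]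
  filter_upwards [h0, h1] with t h0 h1 ht
  exact ⟨lt_of_le_of_ne ht.1 (Ne.symm h0), lt_of_le_of_ne ht.2 h1⟩

/-- Termwise differentiation of the expansion almost everywhere. -/
theorem ae_isTermwiseDifferentiable (h : IsAntitoneExpansion c m H) :
    ∀ᵐ t : ℝ, t ∈ Icc (0 : ℝ) 1 → IsTermwiseDifferentiable c m H t := by
  have hHd := h.absolutelyContinuous.ae_differentiableAt
  have hmd : ∀ᵐ t : ℝ, ∀ n, t ∈ uIcc (0 : ℝ) 1 → DifferentiableAt ℝ (m n) t :=
    ae_all_iff.mpr fun n => (h.absolutelyContinuous_term n).ae_differentiableAt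
  rw [uIcc_of_le zero_le_one] at hHd hmd
  have hgood : ∀ᵐ t : ℝ, t ∈ Icc (0 : ℝ) 1 → t ∈ Ioo (0 : ℝ) 1 ∧ DifferentiableAt ℝ H t ∧
      ∀ n, DifferentiableAt ℝ (m n) t := by
    filter_upwards [hHd, hmd, ae_mem_Ioo] with t h1 h2 h3 ht
    exact ⟨h3 ht, h1 ht, fun n => h2 n ht⟩
  set μ := volume.restrict (Ioc (0 : ℝ) 1) with hμ
  have hgood' : ∀ᵐ t ∂μ, t ∈ Ioo (0 : ℝ) 1 ∧ DifferentiableAt ℝ H t ∧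
      ∀ n, DifferentiableAt ℝ (m n) t := by
    rw [hμ, ae_restrict_iff' measurableSet_Ioc]
    filter_upwards [hgood] with t ht hmem
    exact ht (Ioc_subset_Icc_self hmem)
  have hintm : ∀ n, Integrable (fun t => c n * -deriv (m n) t) μ := fun n => by
    have := (h.absolutelyContinuous_term n).intervalIntegrable_deriv
    rw [intervalIntegrable_iff_integrableOn_Ioc_of_le zero_le_one] at this
    exact this.neg.const_mul (c n)
  have hintH : Integrable (deriv H) μ := by
    have := h.absolutelyContinuous.intervalIntegrable_deriv
    rwa [intervalIntegrable_iff_integrableOn_Ioc_of_le zero_le_one] at this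
  have hvalm : ∀ n, ∫ t, c n * -deriv (m n) t ∂μ = c n * (m n 0 - m n 1) := fun n => by
    have := (h.absolutelyContinuous_term n).integral_deriv_eq_sub
    rw [intervalIntegral.integral_of_le zero_le_one] at this
    rw [integral_const_mul, integral_neg, this]; ring
  have hvalH : ∫ t, deriv H t ∂μ = H 1 - H 0 := by
    have := h.absolutelyContinuous.integral_deriv_eq_sub
    rwa [intervalIntegral.integral_of_le zero_le_one] at this
  have hsumnorm : Summable fun n => ∫ t, ‖c n * -deriv (m n) t‖ ∂μ := by
    refine (h.summable_term_sub 0 1).congr fun n => ?_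
    rw [← hvalm n]
    refine integral_congr_ae ?_
    filter_upwards [hgood'] with t ht
    rw [Real.norm_of_nonneg (h.neg_deriv_nonneg ht.1 (ht.2.2 n))]
  have htsum := integral_tsum_of_summable_integral_norm hintm hsumnorm
  have hle : ∀ᵐ t ∂μ, ∑' n, c n * -deriv (m n) t ≤ deriv H t ∧
      Summable fun n => c n * -deriv (m n) t := by
    filter_upwards [hgood'] with t ht
    have hnn : ∀ n, 0 ≤ c n * -deriv (m n) t := fun n => h.neg_deriv_nonneg ht.1 (ht.2.2 n)
    have hs : Summable fun n => c n * -deriv (m n) t :=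
      summable_of_sum_le hnn (h.sum_neg_deriv_le ht.1 ht.2.1 ht.2.2)
    exact ⟨hs.tsum_le_of_sum_le (h.sum_neg_deriv_le ht.1 ht.2.1 ht.2.2), hs⟩
  have hintS : Integrable (fun t => ∑' n, c n * -deriv (m n) t) μ := by
    refine hintH.mono' ?_ ?_
    · refine aestronglyMeasurable_of_tendsto_ae atTop
        (f := fun N t => ∑ n ∈ Finset.range N, c n * -deriv (m n) t) (fun N => ?_) ?_
      · exact (Finset.measurable_fun_sum _ fun n _ =>
          ((measurable_deriv (m n)).neg.const_mul (c n))).aestronglyMeasurable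
      · filter_upwards [hle] with t ht
        exact ht.2.hasSum.tendsto_sum_nat
    · filter_upwards [hle, hgood'] with t ht hg
      rw [Real.norm_of_nonneg (tsum_nonneg fun n => h.neg_deriv_nonneg hg.1 (hg.2.2 n))]
      exact ht.1
  -- Both sides of the pointwise inequality integrate to `H 1 - H 0`: for `H` and for each `m n` by
  -- absolute continuity, for the sum by exchanging sum and integral. A nonnegative difference with
  -- zero integral vanishes almost everywhere.
  have hzero : ∫ t, (deriv H t - ∑' n, c n * -deriv (m n) t) ∂μ = 0 := by
    rw [integral_sub hintH hintS, ← htsum, hvalH, h.sub_eq_tsum (by simp) (by simp)]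
    simp_rw [hvalm]; ring
  rw [integral_eq_zero_iff_of_nonneg_ae (hle.mono fun t ht => sub_nonneg.mpr ht.1)
    (hintH.sub hintS)] at hzero
  have hfin : ∀ᵐ t ∂μ, IsTermwiseDifferentiable c m H t := by
    filter_upwards [hzero, hle, hgood'] with t h0 h1 h2
    refine ⟨h2.1, h2.2.1, h2.2.2, ?_⟩
    have : deriv H t = ∑' n, c n * -deriv (m n) t := by
      have : deriv H t - ∑' n, c n * -deriv (m n) t = 0 := h0
      linarith
    rw [this]; exact h1.2.hasSum
  rw [hμ, ae_restrict_iff' measurableSet_Ioc] at hfin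
  filter_upwards [hfin, ae_mem_Ioo] with t h1 h2 ht
  exact h1 (Ioo_subset_Ioc_self (h2 ht))

/-- The term quotients are nonnegative and their totals converge to `deriv H t`, so the Scheffé
lemma applies. The weights may move with `x`; the derivative along the diagonal needs this. -/
theorem tendsto_weighted (h : IsAntitoneExpansion c m H) {t : ℝ}
    (ht : IsTermwiseDifferentiable c m H t) {w : ℝ → ℕ → ℝ} {w₀ : ℕ → ℝ}
    (hw_mem : ∀ᶠ x in 𝓝[≠] t, ∀ n, w x n ∈ Icc (0 : ℝ) 1) (hw₀_mem : ∀ n, w₀ n ∈ Icc (0 : ℝ) 1)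
    (hw : ∀ n, Tendsto (fun x => w x n) (𝓝[≠] t) (𝓝 (w₀ n))) :
    Tendsto (fun x => ∑' n, c n * -slope (m n) t x * w x n) (𝓝[≠] t)
      (𝓝 (∑' n, c n * -deriv (m n) t * w₀ n)) := by
  have hIcc := eventually_mem_Icc ht.mem
  have ht' := Ioo_subset_Icc_self ht.mem
  refine tendsto_tsum_mul_of_tendsto_tsum
    (hIcc.mono fun x hx => h.neg_slope_nonneg ht' hx)
    (hIcc.mono fun x hx => (h.hasSum_neg_slope ht' hx).summable)
    (fun n => h.neg_deriv_nonneg ht.mem (ht.differentiableAt_term n)) ht.hasSum.summable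
    (fun n => tendsto_neg_slope (ht.differentiableAt_term n)) ?_ hw_mem hw₀_mem hw
  rw [ht.hasSum.tsum_eq]
  refine (hasDerivAt_iff_tendsto_slope.mp ht.differentiableAt.hasDerivAt).congr' ?_
  filter_upwards [hIcc] with x hx
  exact (h.hasSum_neg_slope ht' hx).tsum_eq.symm

end IsAntitoneExpansion

/-! ### Weighted expansions and the area theorem -/

/-- A function `Φ` of the channel parameters `τ` whose increments in each single parameter are
positive combinations of the increments of the `m n`, with weights that are monotone in `τ`. -/
structure IsWeightedExpansion {ι : Type*} [DecidableEq ι] (c : ℕ → ℝ) (m : ℕ → ℝ → ℝ)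
    (Φ : (ι → ℝ) → ℝ) (w : ι → (ι → ℝ) → ℕ → ℝ) : Prop where
  update_sub_update : ∀ k τ s s', Φ (Function.update τ k s') - Φ (Function.update τ k s) =
    ∑' n, c n * (m n s - m n s') * w k τ n
  weight_mem : ∀ k τ n, w k τ n ∈ Icc (0 : ℝ) 1
  weight_mono : ∀ k n, MonotoneOn (fun τ => w k τ n) (Icc 0 1)

/-- The termwise derivative of the weighted expansion in the parameter `k`, on the diagonal. -/
noncomputable def partialDeriv {ι : Type*} (c : ℕ → ℝ) (m : ℕ → ℝ → ℝ)
    (w : ι → (ι → ℝ) → ℕ → ℝ) (k : ι) (t : ℝ) : ℝ :=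
  ∑' n, c n * -deriv (m n) t * w k (fun _ => t) n

namespace IsWeightedExpansion

theorem const_mem_Icc {ι : Type*} {t : ℝ} (ht : t ∈ Icc (0 : ℝ) 1) :
    (fun _ : ι => t) ∈ Icc (0 : ι → ℝ) 1 :=
  ⟨fun _ => ht.1, fun _ => ht.2⟩

variable {ι : Type*} [DecidableEq ι] {c : ℕ → ℝ} {m : ℕ → ℝ → ℝ} {H : ℝ → ℝ}
  {Φ : (ι → ℝ) → ℝ} {w : ι → (ι → ℝ) → ℕ → ℝ}

theorem slope_update (hΦ : IsWeightedExpansion c m Φ w) (k : ι) (τ : ι → ℝ) (t x : ℝ) :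
    (Φ (Function.update τ k x) - Φ (Function.update τ k t)) / (x - t) =
      ∑' n, c n * -slope (m n) t x * w k τ n := by
  rw [hΦ.update_sub_update, ← tsum_div_const]
  refine tsum_congr fun n => ?_
  rw [slope_def_field]; ring

theorem hasDerivAt_update (hΦ : IsWeightedExpansion c m Φ w) (h : IsAntitoneExpansion c m H)
    {t : ℝ} (ht : IsTermwiseDifferentiable c m H t) (k : ι) :
    HasDerivAt (fun s => Φ (Function.update (fun _ => t) k s)) (partialDeriv c m w k t) t := by
  rw [hasDerivAt_iff_tendsto_slope]
  refine (h.tendsto_weighted ht (w := fun _ => w k fun _ => t)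
    (Eventually.of_forall fun _ => hΦ.weight_mem k _) (hΦ.weight_mem k _)
    fun _ => tendsto_const_nhds).congr fun x => ?_
  rw [slope_def_field, hΦ.slope_update]

theorem summable_partialDeriv (hΦ : IsWeightedExpansion c m Φ w) (h : IsAntitoneExpansion c m H)
    {t : ℝ} (ht : IsTermwiseDifferentiable c m H t) (k : ι) :
    Summable fun n => c n * -deriv (m n) t * w k (fun _ => t) n :=
  Summable.of_nonneg_of_le
    (fun n => mul_nonneg (h.neg_deriv_nonneg ht.mem (ht.differentiableAt_term n))
      (hΦ.weight_mem k _ n).1)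
    (fun n => mul_le_of_le_one_right (h.neg_deriv_nonneg ht.mem (ht.differentiableAt_term n))
      (hΦ.weight_mem k _ n).2) ht.hasSum.summable

theorem partialDeriv_nonneg (hΦ : IsWeightedExpansion c m Φ w) (h : IsAntitoneExpansion c m H)
    {t : ℝ} (ht : IsTermwiseDifferentiable c m H t) (k : ι) : 0 ≤ partialDeriv c m w k t :=
  tsum_nonneg fun n => mul_nonneg (h.neg_deriv_nonneg ht.mem (ht.differentiableAt_term n))
    (hΦ.weight_mem k _ n).1

theorem partialDeriv_le (hΦ : IsWeightedExpansion c m Φ w) (h : IsAntitoneExpansion c m H)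
    {t : ℝ} (ht : IsTermwiseDifferentiable c m H t) (k : ι) :
    partialDeriv c m w k t ≤ deriv H t := by
  rw [← ht.hasSum.tsum_eq]
  exact (hΦ.summable_partialDeriv h ht k).tsum_le_tsum
    (fun n => mul_le_of_le_one_right (h.neg_deriv_nonneg ht.mem (ht.differentiableAt_term n))
      (hΦ.weight_mem k _ n).2) ht.hasSum.summable

theorem partialDeriv_le_partialDeriv {κ : Type*} [DecidableEq κ] {Ψ : (κ → ℝ) → ℝ}
    {v : κ → (κ → ℝ) → ℕ → ℝ} (hΦ : IsWeightedExpansion c m Φ w)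
    (hΨ : IsWeightedExpansion c m Ψ v) (h : IsAntitoneExpansion c m H)
    {t : ℝ} (ht : IsTermwiseDifferentiable c m H t) {k : ι} {l : κ}
    (hle : ∀ n, w k (fun _ => t) n ≤ v l (fun _ => t) n) :
    partialDeriv c m w k t ≤ partialDeriv c m v l t :=
  (hΦ.summable_partialDeriv h ht k).tsum_le_tsum
    (fun n => mul_le_mul_of_nonneg_left (hle n)
      (h.neg_deriv_nonneg ht.mem (ht.differentiableAt_term n))) (hΨ.summable_partialDeriv h ht l)

/-- Domination by `deriv H` gives the bound. Measurability comes from the monotonicity of the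
weights along the diagonal. -/
theorem intervalIntegrable_partialDeriv (hΦ : IsWeightedExpansion c m Φ w)
    (h : IsAntitoneExpansion c m H) (k : ι) :
    IntervalIntegrable (partialDeriv c m w k) volume 0 1 := by
  have hH := h.absolutelyContinuous.intervalIntegrable_deriv
  rw [intervalIntegrable_iff_integrableOn_Ioc_of_le zero_le_one] at hH ⊢
  have hae : ∀ᵐ t ∂volume.restrict (Ioc (0 : ℝ) 1), IsTermwiseDifferentiable c m H t := by
    rw [ae_restrict_iff' measurableSet_Ioc]
    filter_upwards [h.ae_isTermwiseDifferentiable] with t ht hmem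
    exact ht (Ioc_subset_Icc_self hmem)
  refine Integrable.mono' hH ?_ ?_
  · refine aestronglyMeasurable_of_tendsto_ae atTop (f := fun N t => ∑ n ∈ Finset.range N,
      c n * -deriv (m n) t * w k (fun _ => t) n) (fun N => ?_) ?_
    · refine (Finset.aemeasurable_fun_sum _ fun n _ => ?_).aestronglyMeasurable
      refine ((measurable_deriv (m n)).neg.const_mul (c n)).aemeasurable.mul ?_
      refine aemeasurable_restrict_of_monotoneOn measurableSet_Ioc ?_
      intro s hs t ht hst
      exact hΦ.weight_mono k n (const_mem_Icc (Ioc_subset_Icc_self hs))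
        (const_mem_Icc (Ioc_subset_Icc_self ht)) fun _ => hst
    · filter_upwards [hae] with t ht
      exact (hΦ.summable_partialDeriv h ht k).hasSum.tendsto_sum_nat
  · filter_upwards [hae] with t ht
    rw [Real.norm_of_nonneg (hΦ.partialDeriv_nonneg h ht k)]
    exact hΦ.partialDeriv_le h ht k

theorem integral_partialDeriv_le (hΦ : IsWeightedExpansion c m Φ w)
    (h : IsAntitoneExpansion c m H) (k : ι) :
    ∫ t in (0 : ℝ)..1, partialDeriv c m w k t ≤ H 1 - H 0 := by
  rw [← h.absolutelyContinuous.integral_deriv_eq_sub]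
  refine intervalIntegral.integral_mono_ae_restrict zero_le_one
    (hΦ.intervalIntegrable_partialDeriv h k) h.absolutelyContinuous.intervalIntegrable_deriv ?_
  rw [EventuallyLE, ae_restrict_iff' measurableSet_Icc]
  filter_upwards [h.ae_isTermwiseDifferentiable] with t ht hmem
  exact hΦ.partialDeriv_le h (ht hmem) k

/-- Moving one more parameter from `t` to `x`. -/
theorem piecewise_insert_eq_update (S : Finset ι) (k : ι) (x t : ℝ) :
    (insert k S).piecewise (fun _ => x) (fun _ => t) =
      Function.update (S.piecewise (fun _ => x) (fun _ => t)) k x :=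
  Finset.piecewise_insert S _ _ k

theorem piecewise_eq_update {S : Finset ι} {k : ι} (hk : k ∉ S) (x t : ℝ) :
    S.piecewise (fun _ => x) (fun _ => t) =
      Function.update (S.piecewise (fun _ => x) (fun _ => t)) k t := by
  rw [eq_comm, Function.update_eq_self_iff]
  simp [hk]

theorem piecewise_mem_Icc (S : Finset ι) {x t : ℝ} (hx : x ∈ Icc (0 : ℝ) 1)
    (ht : t ∈ Icc (0 : ℝ) 1) :
    S.piecewise (fun _ => x) (fun _ => t) ∈ Icc (0 : ι → ℝ) 1 := by
  refine ⟨fun l => ?_, fun l => ?_⟩ <;> by_cases hl : l ∈ S <;>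
    simp [hl, hx.1, hx.2, ht.1, ht.2]

/-- Sandwich for the weights when some parameters are moved from `t` to `x`. -/
theorem abs_weight_piecewise_sub_le (hΦ : IsWeightedExpansion c m Φ w) (S : Finset ι) (k : ι)
    (n : ℕ) {x t : ℝ} (hx : x ∈ Icc (0 : ℝ) 1) (ht : t ∈ Icc (0 : ℝ) 1) :
    |w k (S.piecewise (fun _ => x) (fun _ => t)) n - w k (fun _ => t) n| ≤
      |w k (fun _ => x) n - w k (fun _ => t) n| := by
  have hp := piecewise_mem_Icc S hx ht
  rcases le_total t x with htx | hxt
  · have h1 := hΦ.weight_mono k n (const_mem_Icc ht) hp fun l => by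
      by_cases hl : l ∈ S <;> simp [hl, htx]
    have h2 := hΦ.weight_mono k n hp (const_mem_Icc hx) fun l => by
      by_cases hl : l ∈ S <;> simp [hl, htx]
    dsimp only at h1 h2
    rw [abs_of_nonneg (by linarith), abs_of_nonneg (by linarith)]; linarith
  · have h1 := hΦ.weight_mono k n (const_mem_Icc hx) hp fun l => by
      by_cases hl : l ∈ S <;> simp [hl, hxt]
    have h2 := hΦ.weight_mono k n hp (const_mem_Icc ht) fun l => by
      by_cases hl : l ∈ S <;> simp [hl, hxt]
    dsimp only at h1 h2
    rw [abs_of_nonpos (by linarith), abs_of_nonpos (by linarith)]; linarith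

/-- Along the diagonal each weight is monotone, hence has countably many discontinuities, and there
are countably many pairs `(k, n)`. -/
theorem ae_continuousAt_weight [Countable ι] (hΦ : IsWeightedExpansion c m Φ w) :
    ∀ᵐ t : ℝ, t ∈ Icc (0 : ℝ) 1 → ∀ k n, ContinuousAt (fun x => w k (fun _ => x) n) t := by
  have hc : ∀ k n, ∀ᵐ t : ℝ, t ∈ Icc (0 : ℝ) 1 →
      ContinuousWithinAt (fun x => w k (fun _ => x) n) (Icc 0 1) t := by
    intro k n
    have hmono : MonotoneOn (fun x => w k (fun _ => x) n) (Icc (0 : ℝ) 1) := fun s hs t ht hst =>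
      hΦ.weight_mono k n (const_mem_Icc hs) (const_mem_Icc ht) fun _ => hst
    have := hmono.countable_not_continuousWithinAt.ae_notMem volume
    filter_upwards [this] with t ht hmem
    by_contra hcon
    exact ht ⟨hmem, hcon⟩
  filter_upwards [ae_all_iff.mpr fun k => ae_all_iff.mpr (hc k),
    IsAntitoneExpansion.ae_mem_Ioo] with t h1 h2 ht k n
  exact (h1 k n ht).continuousAt (Icc_mem_nhds (h2 ht).1 (h2 ht).2)

/-- Parameters are moved from `t` to `x` one at a time. Each move contributes a single-parameter
quotient whose weights sit at a mixed point; by monotonicity they are squeezed between the diagonal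
weights at `t` and `x`, so continuity there suffices. -/
theorem tendsto_slope_piecewise (hΦ : IsWeightedExpansion c m Φ w)
    (h : IsAntitoneExpansion c m H) {t : ℝ} (ht : IsTermwiseDifferentiable c m H t)
    (hc : ∀ k n, ContinuousAt (fun x => w k (fun _ => x) n) t) (S : Finset ι) :
    Tendsto (fun x => (Φ (S.piecewise (fun _ => x) (fun _ => t)) - Φ (fun _ => t)) / (x - t))
      (𝓝[≠] t) (𝓝 (∑ k ∈ S, partialDeriv c m w k t)) := by
  induction S using Finset.induction_on with
  | empty => simp
  | insert k S hk ih =>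
    rw [Finset.sum_insert hk]
    have hIcc := IsAntitoneExpansion.eventually_mem_Icc ht.mem
    have hstep := h.tendsto_weighted ht
      (w := fun x => w k (S.piecewise (fun _ => x) (fun _ => t))) (w₀ := w k fun _ => t)
      (Eventually.of_forall fun x => hΦ.weight_mem k _) (hΦ.weight_mem k _) (fun n => by
        have hcn : Tendsto (fun x => w k (fun _ => x) n) (𝓝[≠] t) (𝓝 (w k (fun _ => t) n)) :=
          (hc k n).mono_left nhdsWithin_le_nhds
        rw [tendsto_iff_dist_tendsto_zero] at hcn ⊢
        refine squeeze_zero' (Eventually.of_forall fun _ => dist_nonneg) ?_ hcn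
        filter_upwards [hIcc] with x hx
        exact hΦ.abs_weight_piecewise_sub_le S k n hx (Ioo_subset_Icc_self ht.mem))
    refine (hstep.add ih).congr fun x => ?_
    rw [← hΦ.slope_update, ← piecewise_insert_eq_update, ← piecewise_eq_update hk]
    ring

theorem hasDerivAt_diagonal [Fintype ι] (hΦ : IsWeightedExpansion c m Φ w)
    (h : IsAntitoneExpansion c m H) {t : ℝ} (ht : IsTermwiseDifferentiable c m H t)
    (hc : ∀ k n, ContinuousAt (fun x => w k (fun _ => x) n) t) :
    HasDerivAt (fun x => Φ fun _ => x) (∑ k, partialDeriv c m w k t) t := by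
  rw [hasDerivAt_iff_tendsto_slope]
  refine (hΦ.tendsto_slope_piecewise h ht hc Finset.univ).congr fun x => ?_
  rw [slope_def_field, Finset.piecewise_univ]

theorem update_sub_update_mem (hΦ : IsWeightedExpansion c m Φ w) (h : IsAntitoneExpansion c m H)
    (k : ι) (τ : ι → ℝ) {t x : ℝ} (ht : t ∈ Icc (0 : ℝ) 1) (hx : x ∈ Icc (0 : ℝ) 1)
    (htx : t ≤ x) :
    Φ (Function.update τ k x) - Φ (Function.update τ k t) ∈ Icc 0 (H x - H t) := by
  have hnn := h.term_sub_nonneg ht hx htx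
  rw [hΦ.update_sub_update, h.sub_eq_tsum ht hx]
  have hle : ∀ n, c n * (m n t - m n x) * w k τ n ≤ c n * (m n t - m n x) := fun n =>
    mul_le_of_le_one_right (hnn n) (hΦ.weight_mem k τ n).2
  have hnn' : ∀ n, 0 ≤ c n * (m n t - m n x) * w k τ n := fun n =>
    mul_nonneg (hnn n) (hΦ.weight_mem k τ n).1
  exact ⟨tsum_nonneg hnn', (Summable.of_nonneg_of_le hnn' hle
    (h.summable_term_sub t x)).tsum_le_tsum hle (h.summable_term_sub t x)⟩

theorem piecewise_sub_mem (hΦ : IsWeightedExpansion c m Φ w) (h : IsAntitoneExpansion c m H)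
    {t x : ℝ} (ht : t ∈ Icc (0 : ℝ) 1) (hx : x ∈ Icc (0 : ℝ) 1) (htx : t ≤ x) (S : Finset ι) :
    Φ (S.piecewise (fun _ => x) (fun _ => t)) - Φ (fun _ => t) ∈
      Icc 0 (S.card * (H x - H t)) := by
  induction S using Finset.induction_on with
  | empty => simp
  | insert k S hk ih =>
    have h1 := hΦ.update_sub_update_mem h k (S.piecewise (fun _ => x) (fun _ => t)) ht hx htx
    rw [← piecewise_insert_eq_update, ← piecewise_eq_update hk] at h1
    rw [Finset.card_insert_of_notMem hk]
    push_cast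
    constructor
    · linarith [h1.1, ih.1]
    · linarith [h1.2, ih.2]

theorem absolutelyContinuous_diagonal [Fintype ι] (hΦ : IsWeightedExpansion c m Φ w)
    (h : IsAntitoneExpansion c m H) :
    AbsolutelyContinuousOnInterval (fun x => Φ fun _ => x) 0 1 := by
  refine h.absolutelyContinuous.of_dist_le (C := Fintype.card ι) ?_
  rw [uIcc_of_le zero_le_one]
  have key : ∀ x ∈ Icc (0 : ℝ) 1, ∀ y ∈ Icc (0 : ℝ) 1, x ≤ y →
      dist (Φ fun _ => x) (Φ fun _ => y) ≤ Fintype.card ι * dist (H x) (H y) := by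
    intro x hx y hy hxy
    have h1 := hΦ.piecewise_sub_mem h hx hy hxy Finset.univ
    rw [Finset.piecewise_univ, Finset.card_univ] at h1
    rw [dist_comm, dist_comm (H x), Real.dist_eq, Real.dist_eq, abs_of_nonneg h1.1,
      abs_of_nonneg (sub_nonneg.mpr (h.monotoneOn hx hy hxy))]
    exact h1.2
  intro x hx y hy
  rcases le_total x y with hxy | hxy
  · exact key x hx y hy hxy
  · rw [dist_comm (Φ _), dist_comm (H x)]; exact key y hy x hx hxy

/-- The area theorem: the partial derivatives along the diagonal integrate to the increment. -/
theorem sum_integral_partialDeriv [Fintype ι] (hΦ : IsWeightedExpansion c m Φ w)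
    (h : IsAntitoneExpansion c m H) :
    ∑ k, ∫ t in (0 : ℝ)..1, partialDeriv c m w k t = (Φ fun _ => 1) - Φ fun _ => 0 := by
  rw [← intervalIntegral.integral_finsetSum fun k _ => hΦ.intervalIntegrable_partialDeriv h k,
    ← (hΦ.absolutelyContinuous_diagonal h).integral_deriv_eq_sub]
  refine intervalIntegral.integral_congr_ae ?_
  filter_upwards [h.ae_isTermwiseDifferentiable, hΦ.ae_continuousAt_weight] with t h1 h2 ht
  rw [uIoc_of_le zero_le_one] at ht
  have ht' := Ioc_subset_Icc_self ht
  exact (hΦ.hasDerivAt_diagonal h (h1 ht') (h2 ht')).deriv.symm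

end IsWeightedExpansion

/-! ### Soft-bit representation of symmetric channels -/

theorem integrable_of_abs_le {α : Type*} [MeasurableSpace α] {μ : Measure α} [IsFiniteMeasure μ]
    {f : α → ℝ} (hf : Measurable f) {C : ℝ} (hC : ∀ x, |f x| ≤ C) : Integrable f μ :=
  Integrable.of_bound hf.aestronglyMeasurable C (Eventually.of_forall hC)

/-- Soft bits: the possible values of the conditional mean of a uniform `±1` input. -/
abbrev SoftBit : Type := Icc (-1 : ℝ) 1

theorem SoftBit.abs_le_one (d : SoftBit) : |(d : ℝ)| ≤ 1 := abs_le.mpr d.2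

/-- Reflection of a soft bit. -/
def SoftBit.reflect (d : SoftBit) : SoftBit :=
  ⟨-d, by linarith [d.2.2], by linarith [d.2.1]⟩

theorem SoftBit.measurable_reflect : Measurable SoftBit.reflect :=
  (measurable_subtype_coe.neg).subtype_mk

theorem Int.units_mul_le_one (x : ℤˣ) (d : SoftBit) : |((x : ℤ) : ℝ) * d| ≤ 1 := by
  rcases Int.units_eq_one_or x with rfl | rfl <;> simpa using SoftBit.abs_le_one d

/-- The likelihood of a soft bit given the input, relative to its law for a uniform input. -/
noncomputable def likelihood (x : ℤˣ) (d : SoftBit) : ℝ := 1 + ((x : ℤ) : ℝ) * d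

theorem likelihood_nonneg (x : ℤˣ) (d : SoftBit) : 0 ≤ likelihood x d := by
  have := (abs_le.mp (Int.units_mul_le_one x d)).1
  unfold likelihood; linarith

theorem likelihood_le_two (x : ℤˣ) (d : SoftBit) : likelihood x d ≤ 2 := by
  have := (abs_le.mp (Int.units_mul_le_one x d)).2
  unfold likelihood; linarith

theorem measurable_likelihood (x : ℤˣ) : Measurable (likelihood x) :=
  (measurable_subtype_coe.const_mul _).const_add 1

namespace BMSChannel

variable (V : BMSChannel)

instance isProbabilityMeasure_law (x : ℤˣ) : IsProbabilityMeasure (V.law x) := V.isProb x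

/-- The output law for a uniform input. -/
noncomputable def mixture : Measure EReal := (2⁻¹ : ℝ≥0∞) • (V.law 1 + V.law (-1))

instance isProbabilityMeasure_mixture : IsProbabilityMeasure V.mixture := by
  constructor
  simp only [mixture, Measure.smul_apply, Measure.add_apply, measure_univ, smul_eq_mul]
  rw [one_add_one_eq_two, ENNReal.inv_mul_cancel (by simp) (by simp)]

theorem two_smul_mixture : (2 : ℝ≥0∞) • V.mixture = V.law 1 + V.law (-1) := by
  rw [mixture, smul_smul, ENNReal.mul_inv_cancel (by simp) (by simp), one_smul]

/-- The conditional mean of a uniform input given the output. -/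
noncomputable def softBit (y : EReal) : SoftBit :=
  projIcc (-1) 1 (by norm_num) (((V.law 1).rnDeriv V.mixture y).toReal - 1)

theorem measurable_softBit : Measurable V.softBit :=
  continuous_projIcc.measurable.comp
    ((Measure.measurable_rnDeriv _ _).ennreal_toReal.sub_const 1)

theorem law_one_le : V.law 1 ≤ (2 : ℝ≥0∞) • V.mixture := by
  rw [two_smul_mixture]; exact Measure.le_add_right le_rfl

theorem law_one_absolutelyContinuous : V.law 1 ≪ V.mixture :=
  (Measure.absolutelyContinuous_of_le V.law_one_le).trans
    (Measure.smul_absolutelyContinuous)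

/-- The law given `+1` is at most twice the mixture, so its density lies in `[0,2]` almost
everywhere and the clipping in `softBit` changes nothing there. -/
theorem rnDeriv_ae_eq : (V.law 1).rnDeriv V.mixture =ᵐ[V.mixture]
    fun y => ENNReal.ofReal (likelihood 1 (V.softBit y)) := by
  have hle : (V.law 1).rnDeriv V.mixture ≤ᵐ[V.mixture] fun _ => 2 := by
    refine ae_le_of_forall_setLIntegral_le_of_sigmaFinite (Measure.measurable_rnDeriv _ _)
      fun s _ _ => ?_
    rw [Measure.setLIntegral_rnDeriv V.law_one_absolutelyContinuous, setLIntegral_const]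
    exact V.law_one_le s
  filter_upwards [hle] with y hy
  have h2 : ((V.law 1).rnDeriv V.mixture y).toReal ≤ 2 :=
    ENNReal.toReal_le_of_le_ofReal (by norm_num) (by simpa using hy)
  have h0 : 0 ≤ ((V.law 1).rnDeriv V.mixture y).toReal := ENNReal.toReal_nonneg
  rw [likelihood, softBit, projIcc_of_mem (by norm_num) ⟨by linarith, by linarith⟩]
  simp only [Units.val_one, Int.cast_one, one_mul, add_sub_cancel]
  rw [ENNReal.ofReal_toReal (ne_top_of_le_ne_top (by simp) hy)]

theorem measurable_density (x : ℤˣ) :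
    Measurable fun y => ENNReal.ofReal (likelihood x (V.softBit y)) :=
  ((measurable_likelihood x).comp V.measurable_softBit).ennreal_ofReal

/-- For input `+1` this is Radon–Nikodym. For `-1`, the two likelihoods add up to `2`, just as the
two laws add up to twice the mixture. -/
theorem law_eq_withDensity (x : ℤˣ) :
    V.law x = V.mixture.withDensity fun y => ENNReal.ofReal (likelihood x (V.softBit y)) := by
  have h1 : V.law 1 =
      V.mixture.withDensity fun y => ENNReal.ofReal (likelihood 1 (V.softBit y)) := by
    rw [← withDensity_congr_ae V.rnDeriv_ae_eq,
      Measure.withDensity_rnDeriv_eq _ _ V.law_one_absolutelyContinuous]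
  rcases Int.units_eq_one_or x with rfl | rfl
  · exact h1
  · have hadd : V.mixture.withDensity (fun y => ENNReal.ofReal (likelihood 1 (V.softBit y))) +
        V.mixture.withDensity (fun y => ENNReal.ofReal (likelihood (-1) (V.softBit y))) =
        V.law 1 + V.law (-1) := by
      rw [← withDensity_add_left (V.measurable_density 1), ← two_smul_mixture, ← withDensity_const]
      congr 1
      ext y
      simp only [Pi.add_apply]
      rw [← ENNReal.ofReal_add (likelihood_nonneg _ _) (likelihood_nonneg _ _)]
      have : likelihood 1 (V.softBit y) + likelihood (-1) (V.softBit y) = 2 := by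
        simp only [likelihood]; push_cast; ring
      rw [this]; norm_num
    rw [← h1] at hadd
    ext s hs
    have := congrArg (fun μ : Measure EReal => μ s) hadd
    simp only [Measure.add_apply] at this
    exact ((ENNReal.add_right_inj (measure_ne_top _ s)).mp this).symm

/-- The law of the soft bit for a uniform input. -/
noncomputable def softLaw : Measure SoftBit := V.mixture.map V.softBit

instance isProbabilityMeasure_softLaw : IsProbabilityMeasure V.softLaw :=
  Measure.isProbabilityMeasure_map V.measurable_softBit.aemeasurable

theorem integral_softLaw {f : SoftBit → ℝ} (hf : Measurable f) :
    ∫ d, f d ∂V.softLaw = ∫ y, f (V.softBit y) ∂V.mixture :=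
  integral_map V.measurable_softBit.aemeasurable hf.aestronglyMeasurable

theorem measurable_neg_ereal : Measurable fun y : EReal => -y := continuous_neg.measurable

theorem map_neg_law (x : ℤˣ) : (V.law x).map (fun y => -y) = V.law (-x) := by
  rcases Int.units_eq_one_or x with rfl | rfl
  · rw [V.symm, Measure.map_map measurable_neg_ereal measurable_neg_ereal]
    simp
  · simp [V.symm]

theorem measurePreserving_neg_mixture :
    MeasurePreserving (fun y : EReal => -y) V.mixture V.mixture := by
  refine ⟨measurable_neg_ereal, ?_⟩
  rw [mixture, Measure.map_smul, Measure.map_add _ _ measurable_neg_ereal, map_neg_law,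
    map_neg_law, neg_neg, add_comm]

/-- Reflecting the output preserves the mixture and exchanges the two laws, so by uniqueness of
densities it exchanges `1 + d` and `1 - d`. -/
theorem softBit_neg_ae_eq :
    (fun y => V.softBit (-y)) =ᵐ[V.mixture] fun y => (V.softBit y).reflect := by
  have h1 : V.mixture.withDensity (fun y => ENNReal.ofReal (likelihood 1 (V.softBit (-y)))) =
      V.mixture.withDensity fun y => ENNReal.ofReal (likelihood (-1) (V.softBit y)) := by
    rw [← law_eq_withDensity, ← map_neg_law]
    ext s hs
    rw [Measure.map_apply measurable_neg_ereal hs, V.law_eq_withDensity 1,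
      withDensity_apply _ hs, withDensity_apply _ (measurable_neg_ereal hs)]
    have := V.measurePreserving_neg_mixture.setLIntegral_comp_preimage
      (measurable_neg_ereal hs) (V.measurable_density 1)
    rw [← this]
    congr 2
    ext y; simp
  rw [withDensity_eq_iff_of_sigmaFinite (f := fun y => ENNReal.ofReal (likelihood 1 (V.softBit (-y))))
    ((V.measurable_density 1).comp measurable_neg_ereal).aemeasurable
    (V.measurable_density (-1)).aemeasurable] at h1
  filter_upwards [h1] with y hy
  rw [ENNReal.ofReal_eq_ofReal_iff (likelihood_nonneg _ _) (likelihood_nonneg _ _)] at hy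
  simp only [likelihood] at hy
  refine Subtype.ext ?_
  simp only [SoftBit.reflect]
  push_cast at hy
  linarith

theorem measurePreserving_reflect : MeasurePreserving SoftBit.reflect V.softLaw V.softLaw := by
  refine ⟨SoftBit.measurable_reflect, ?_⟩
  rw [softLaw, Measure.map_map SoftBit.measurable_reflect V.measurable_softBit]
  have : SoftBit.reflect ∘ V.softBit =ᵐ[V.mixture] V.softBit ∘ fun y => -y :=
    V.softBit_neg_ae_eq.symm
  rw [Measure.map_congr this, ← Measure.map_map V.measurable_softBit measurable_neg_ereal,
    V.measurePreserving_neg_mixture.map_eq]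

theorem integral_softLaw_coe : ∫ d, (d : ℝ) ∂V.softLaw = 0 := by
  have h := V.measurePreserving_reflect.integral_comp' (f := ⟨⟨SoftBit.reflect, SoftBit.reflect,
    fun d => Subtype.ext (neg_neg _), fun d => Subtype.ext (neg_neg _)⟩,
    SoftBit.measurable_reflect, SoftBit.measurable_reflect⟩) (fun d => (d : ℝ))
  have h' : ∫ d, -(d : ℝ) ∂V.softLaw = ∫ d, (d : ℝ) ∂V.softLaw := h
  rw [integral_neg] at h'
  linarith

theorem integral_law (x : ℤˣ) (φ : EReal → ℝ) :
    ∫ y, φ y ∂V.law x = ∫ y, likelihood x (V.softBit y) * φ y ∂V.mixture := by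
  rw [V.law_eq_withDensity x, integral_withDensity_eq_integral_toReal_smul
    (V.measurable_density x)
    (Eventually.of_forall fun _ => ENNReal.ofReal_lt_top)]
  simp [ENNReal.toReal_ofReal (likelihood_nonneg _ _)]

/-- Correlation with the soft bit is expressed through the two conditional laws, which are what a
degradation kernel acts on. -/
theorem integral_softBit_mul {φ : EReal → ℝ} (hφ : Measurable φ) {C : ℝ} (hC : ∀ y, |φ y| ≤ C) :
    ∫ y, (V.softBit y : ℝ) * φ y ∂V.mixture =
      2⁻¹ * (∫ y, φ y ∂V.law 1 - ∫ y, φ y ∂V.law (-1)) := by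
  have hi : ∀ x, Integrable (fun y => likelihood x (V.softBit y) * φ y) V.mixture := fun x => by
    refine integrable_of_abs_le (C := 2 * C)
      (((measurable_likelihood x).comp V.measurable_softBit).mul hφ) fun y => ?_
    rw [abs_mul, abs_of_nonneg (likelihood_nonneg _ _)]
    exact mul_le_mul (likelihood_le_two _ _) (hC y) (abs_nonneg _) (by norm_num)
  rw [integral_law, integral_law, ← integral_sub (hi 1) (hi (-1)), ← integral_const_mul]
  refine integral_congr_ae (Eventually.of_forall fun y => ?_)
  simp [likelihood]
  ring

theorem IsDegradedOf.mixture_eq {V W : BMSChannel} {K : Kernel EReal EReal}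
    (hK : ∀ x, V.law x = (W.law x).bind K) : V.mixture = W.mixture.bind K := by
  rw [mixture, mixture, hK, hK]
  ext s hs
  simp only [Measure.smul_apply, Measure.add_apply,
    Measure.bind_apply hs K.measurable.aemeasurable, lintegral_smul_measure,
    lintegral_add_measure]

/-- Degradation decreases the soft bit in the convex order: `g` is a subgradient of `f`. -/
theorem IsDegradedOf.integral_softLaw_le {V W : BMSChannel} (h : V.IsDegradedOf W)
    {f g : SoftBit → ℝ} (hf : Measurable f) (hg : Measurable g) {C : ℝ} (hfC : ∀ d, |f d| ≤ C)
    (hgC : ∀ d, |g d| ≤ C) (htangent : ∀ d d₀ : SoftBit, f d₀ + g d₀ * (d - d₀) ≤ f d) :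
    ∫ d, f d ∂V.softLaw ≤ ∫ d, f d ∂W.softLaw := by
  obtain ⟨K, hKM, hK⟩ := h
  have hmix := IsDegradedOf.mixture_eq hK
  have hfV : Measurable fun y => f (V.softBit y) := hf.comp V.measurable_softBit
  have hgV : Measurable fun y => g (V.softBit y) := hg.comp V.measurable_softBit
  have hdV : Measurable fun y => (V.softBit y : ℝ) :=
    measurable_subtype_coe.comp V.measurable_softBit
  have hdW : Measurable fun y => (W.softBit y : ℝ) :=
    measurable_subtype_coe.comp W.measurable_softBit
  have hbind : ∀ {μ ν : Measure EReal} [IsProbabilityMeasure μ] [IsProbabilityMeasure ν]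
      (_ : ν = μ.bind K) {φ : EReal → ℝ} (_ : Measurable φ) {B : ℝ} (_ : ∀ y, |φ y| ≤ B),
      ∫ y, φ y ∂ν = ∫ y, ∫ z, φ z ∂K y ∂μ := by
    intro μ ν _ _ hν φ hφ B hB
    subst hν
    rw [← Measure.snd_compProd, Measure.snd, integral_map measurable_snd.aemeasurable
      hφ.aestronglyMeasurable, Measure.integral_compProd
      (integrable_of_abs_le (f := fun x : EReal × EReal => φ x.2) (hφ.comp measurable_snd)
        fun y => hB _)]
  have hC0 : 0 ≤ C := (abs_nonneg _).trans (hfC ⟨0, by norm_num⟩)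
  have hgd : ∀ y, |g (V.softBit y) * (V.softBit y : ℝ)| ≤ C := fun y => by
    rw [abs_mul]
    exact (mul_le_of_le_one_right (abs_nonneg _) (SoftBit.abs_le_one _)).trans (hgC _)
  have hA : ∀ y, |f (V.softBit y) - g (V.softBit y) * (V.softBit y : ℝ)| ≤ 2 * C := fun y =>
    (abs_sub _ _).trans (by linarith [hfC (V.softBit y), hgd y])
  have hAm : Measurable fun y => f (V.softBit y) - g (V.softBit y) * (V.softBit y : ℝ) :=
    hfV.sub (hgV.mul hdV)
  have hKint : ∀ {φ : EReal → ℝ} (_ : Measurable φ), Measurable fun y => ∫ z, φ z ∂K y :=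
    fun hφ => (StronglyMeasurable.integral_kernel hφ.stronglyMeasurable).measurable
  have hKbd : ∀ {φ : EReal → ℝ} {B : ℝ} (_ : ∀ y, |φ y| ≤ B), ∀ y, |∫ z, φ z ∂K y| ≤ B := by
    intro φ B hB y
    have := norm_integral_le_of_norm_le_const (μ := K y) (f := φ) (Eventually.of_forall hB)
    simpa using this
  -- The martingale property: the kernel does not see the input, so in correlations with functions
  -- of the degraded output, the soft bit of `W` may be replaced by that of `V`.
  have hswap : ∫ y, (W.softBit y : ℝ) * ∫ z, g (V.softBit z) ∂K y ∂W.mixture =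
      ∫ y, g (V.softBit y) * (V.softBit y : ℝ) ∂V.mixture := by
    rw [W.integral_softBit_mul (hKint hgV) (hKbd fun y => hgC _),
      ← hbind (hK 1) hgV fun y => hgC _, ← hbind (hK (-1)) hgV fun y => hgC _,
      ← V.integral_softBit_mul hgV fun y => hgC _]
    simp_rw [mul_comm]
  -- The tangent inequality at the degraded soft bit, averaged over the kernel; integrating it and
  -- using `hswap` to cancel the linear terms is Jensen's inequality.
  have hpt : ∀ y, ∫ z, (f (V.softBit z) - g (V.softBit z) * (V.softBit z : ℝ)) ∂K y +
      (W.softBit y : ℝ) * ∫ z, g (V.softBit z) ∂K y ≤ f (W.softBit y) := by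
    intro y
    have i1 : Integrable (fun z => f (V.softBit z) - g (V.softBit z) * (V.softBit z : ℝ)) (K y) :=
      integrable_of_abs_le hAm hA
    have i2 : Integrable (fun z => (W.softBit y : ℝ) * g (V.softBit z)) (K y) :=
      (integrable_of_abs_le hgV fun y => hgC _).const_mul _
    rw [← integral_const_mul, ← integral_add i1 i2]
    have : f (W.softBit y) = ∫ _, f (W.softBit y) ∂K y := by simp
    rw [this]
    refine integral_mono (i1.add i2) (integrable_const _) fun z => ?_
    have := htangent (W.softBit y) (V.softBit z)
    simp only
    linarith
  rw [V.integral_softLaw hf, W.integral_softLaw hf]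
  have iA : Integrable (fun y => ∫ z, (f (V.softBit z) -
      g (V.softBit z) * (V.softBit z : ℝ)) ∂K y) W.mixture :=
    integrable_of_abs_le (hKint hAm) (hKbd hA)
  have iB : Integrable (fun y => (W.softBit y : ℝ) * ∫ z, g (V.softBit z) ∂K y) W.mixture := by
    refine integrable_of_abs_le (C := C) (hdW.mul (hKint hgV)) fun y => ?_
    rw [abs_mul]
    exact (mul_le_of_le_one_left (abs_nonneg _) (SoftBit.abs_le_one _)).trans
      (hKbd (fun y => hgC _) y)
  have iF : Integrable (fun y => f (V.softBit y)) V.mixture :=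
    integrable_of_abs_le hfV fun y => hfC _
  have iG : Integrable (fun y => g (V.softBit y) * (V.softBit y : ℝ)) V.mixture :=
    integrable_of_abs_le (hgV.mul hdV) hgd
  calc ∫ y, f (V.softBit y) ∂V.mixture
      = ∫ y, (f (V.softBit y) - g (V.softBit y) * (V.softBit y : ℝ)) ∂V.mixture +
        ∫ y, g (V.softBit y) * (V.softBit y : ℝ) ∂V.mixture := by
        rw [integral_sub iF iG]; ring
    _ = ∫ y, (∫ z, (f (V.softBit z) - g (V.softBit z) * (V.softBit z : ℝ)) ∂K y +
        (W.softBit y : ℝ) * ∫ z, g (V.softBit z) ∂K y) ∂W.mixture := by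
        rw [integral_add iA iB, hswap, hbind hmix hAm hA]
    _ ≤ ∫ y, f (W.softBit y) ∂W.mixture :=
        integral_mono (iA.add iB) (integrable_of_abs_le (hf.comp W.measurable_softBit)
          fun y => hfC _) hpt

theorem IsUninformative.softLaw_ae_eq_zero {V : BMSChannel} (h : V.IsUninformative) :
    ∀ᵐ d : SoftBit ∂V.softLaw, (d : ℝ) = 0 := by
  have h1 := h
  rw [IsUninformative, V.law_eq_withDensity 1, V.law_eq_withDensity (-1),
    withDensity_eq_iff_of_sigmaFinite
      (V.measurable_density _).aemeasurable (V.measurable_density _).aemeasurable] at h1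
  refine (ae_map_iff V.measurable_softBit.aemeasurable
    (measurable_subtype_coe (measurableSet_singleton 0))).mpr ?_
  filter_upwards [h1] with y hy
  rw [ENNReal.ofReal_eq_ofReal_iff (likelihood_nonneg _ _) (likelihood_nonneg _ _)] at hy
  simp only [likelihood] at hy
  push_cast at hy
  show (V.softBit y : ℝ) = 0
  linarith

/-- If the soft bit is neither `1` nor `-1`, both inputs have positive likelihood and the decoder
would have to return both of them. -/
theorem IsPerfect.softLaw_ae_sq_eq_one {V : BMSChannel} (h : V.IsPerfect) :
    ∀ᵐ d : SoftBit ∂V.softLaw, (d : ℝ) = 1 ∨ (d : ℝ) = -1 := by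
  obtain ⟨φ, hφ, hdec⟩ := h
  have key : ∀ x, ∀ᵐ y ∂V.mixture, likelihood x (V.softBit y) ≠ 0 → φ y = x := by
    intro x
    have := hdec x
    rw [V.law_eq_withDensity x, ae_withDensity_iff (V.measurable_density x)] at this
    filter_upwards [this] with y hy hne
    refine hy ?_
    rw [Ne, ENNReal.ofReal_eq_zero, not_le]
    exact lt_of_le_of_ne (likelihood_nonneg _ _) hne.symm
  refine (ae_map_iff V.measurable_softBit.aemeasurable
    ((measurable_subtype_coe (measurableSet_singleton 1)).union
      (measurable_subtype_coe (measurableSet_singleton (-1))))).mpr ?_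
  filter_upwards [key 1, key (-1)] with y h1 h2
  show (V.softBit y : ℝ) = 1 ∨ (V.softBit y : ℝ) = -1
  by_contra hcon
  rw [not_or] at hcon
  have e1 := h1 fun h0 => hcon.2 (by simp only [likelihood] at h0; push_cast at h0; linarith)
  have e2 := h2 fun h0 => hcon.1 (by simp only [likelihood] at h0; push_cast at h0; linarith)
  rw [e1] at e2
  exact absurd e2 (by decide)

end BMSChannel

/-! ### Conditional entropy as an integral over soft bits -/

/-- The homogeneous extension of the entropy (in nats) to unnormalized weights. -/
noncomputable def weightEntropy {A : Type*} [Fintype A] (v : A → ℝ) : ℝ :=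
  ∑ a, Real.negMulLog (v a) - Real.negMulLog (∑ a, v a)

theorem sum_mul_sum_negMulLog_div {A : Type*} [Fintype A] {v : A → ℝ} (hv : ∀ a, 0 ≤ v a) :
    (∑ a, v a) * ∑ a, Real.negMulLog (v a / ∑ b, v b) = weightEntropy v := by
  rcases eq_or_ne (∑ a, v a) 0 with h0 | h0
  · have hz : ∀ a, v a = 0 := fun a =>
      (Finset.sum_eq_zero_iff_of_nonneg fun a _ => hv a).mp h0 a (Finset.mem_univ a)
    simp [weightEntropy, hz]
  · have : ∀ a, (∑ b, v b) * Real.negMulLog (v a / ∑ b, v b) =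
        Real.negMulLog (v a) + v a * Real.log (∑ b, v b) := by
      intro a
      rcases eq_or_ne (v a) 0 with ha | ha
      · simp [ha]
      · rw [Real.negMulLog, Real.negMulLog, Real.log_div ha h0]
        field_simp
        ring
    rw [Finset.mul_sum, Finset.sum_congr rfl fun a _ => this a, Finset.sum_add_distrib,
      ← Finset.sum_mul, weightEntropy, Real.negMulLog]
    ring

theorem continuous_weightEntropy {A : Type*} [Fintype A] :
    Continuous (weightEntropy : (A → ℝ) → ℝ) := by
  unfold weightEntropy
  fun_prop

section Density

variable {A Y : Type*} [Fintype A] [MeasurableSpace Y]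

theorem outputLaw_withDensity (p : PMF A) {ν : Measure Y} {f : A → Y → ℝ}
    (hf : ∀ a, Measurable (f a)) (hf0 : ∀ a y, 0 ≤ f a y) :
    outputLaw p (fun a => ν.withDensity fun y => ENNReal.ofReal (f a y)) =
      ν.withDensity fun y => ENNReal.ofReal (∑ a, (p a).toReal * f a y) := by
  ext s hs
  simp only [outputLaw, Measure.coe_finsetSum, Finset.sum_apply, Measure.smul_apply,
    withDensity_apply _ hs, smul_eq_mul]
  have : ∀ y, ENNReal.ofReal (∑ a, (p a).toReal * f a y) =
      ∑ a, p a * ENNReal.ofReal (f a y) := fun y => by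
    rw [ENNReal.ofReal_sum_of_nonneg fun a _ => mul_nonneg ENNReal.toReal_nonneg (hf0 a y)]
    refine Finset.sum_congr rfl fun a _ => ?_
    rw [ENNReal.ofReal_mul ENNReal.toReal_nonneg, ENNReal.ofReal_toReal (p.apply_ne_top a)]
  simp_rw [this]
  rw [lintegral_finsetSum _ fun a _ => ((hf a).ennreal_ofReal.const_mul _)]
  refine Finset.sum_congr rfl fun a _ => ?_
  rw [lintegral_const_mul _ (hf a).ennreal_ofReal]

theorem posteriorProb_withDensity (p : PMF A) {ν : Measure Y} [IsFiniteMeasure ν]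
    {f : A → Y → ℝ} (hf : ∀ a, Measurable (f a)) (hf0 : ∀ a y, 0 ≤ f a y) (a : A) :
    posteriorProb p (fun a => ν.withDensity fun y => ENNReal.ofReal (f a y)) a
      =ᵐ[ν.withDensity fun y => ENNReal.ofReal (∑ a, (p a).toReal * f a y)]
      fun y => (p a).toReal * f a y / ∑ b, (p b).toReal * f b y := by
  have hg0 : ∀ b y, 0 ≤ (p b).toReal * f b y := fun b y =>
    mul_nonneg ENNReal.toReal_nonneg (hf0 b y)
  have hgm : ∀ b, Measurable fun y => (p b).toReal * f b y := fun b => (hf b).const_mul _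
  have hsm : Measurable fun y => ∑ b, (p b).toReal * f b y :=
    Finset.measurable_fun_sum _ fun b _ => hgm b
  set Q := fun y => ENNReal.ofReal (∑ b, (p b).toReal * f b y)
  have hr : Measurable fun y => ENNReal.ofReal ((p a).toReal * f a y /
      ∑ b, (p b).toReal * f b y) := ((hgm a).div hsm).ennreal_ofReal
  have heq : p a • ν.withDensity (fun y => ENNReal.ofReal (f a y)) =
      (ν.withDensity Q).withDensity fun y => ENNReal.ofReal ((p a).toReal * f a y /
        ∑ b, (p b).toReal * f b y) := by
    rw [← withDensity_mul₀ hsm.ennreal_ofReal.aemeasurable hr.aemeasurable,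
      ← withDensity_smul _ (hf a).ennreal_ofReal]
    congr 1
    ext y
    simp only [Pi.smul_apply, Pi.mul_apply, smul_eq_mul]
    rw [← ENNReal.ofReal_mul (Finset.sum_nonneg fun b _ => hg0 b y)]
    have : (∑ b, (p b).toReal * f b y) * ((p a).toReal * f a y / ∑ b, (p b).toReal * f b y) =
        (p a).toReal * f a y := by
      rcases eq_or_ne (∑ b, (p b).toReal * f b y) 0 with h0 | h0
      · rw [(Finset.sum_eq_zero_iff_of_nonneg fun b _ => hg0 b y).mp h0 a (Finset.mem_univ a)]
        simp
      · field_simp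
    rw [this, ENNReal.ofReal_mul ENNReal.toReal_nonneg, ENNReal.ofReal_toReal (p.apply_ne_top a)]
  have := Measure.rnDeriv_withDensity (ν.withDensity Q) hr
  rw [← heq] at this
  filter_upwards [this] with y hy
  rw [posteriorProb, outputLaw_withDensity p hf hf0, hy, ENNReal.toReal_ofReal]
  exact div_nonneg (hg0 a y) (Finset.sum_nonneg fun b _ => hg0 b y)

/-- The output density times the entropy of the posterior is the homogeneous entropy of the joint
weights. Posteriors and normalizations thus disappear, including where the output density is zero.
-/
theorem condEntropy_withDensity (p : PMF A) {ν : Measure Y} [IsFiniteMeasure ν]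
    {f : A → Y → ℝ} (hf : ∀ a, Measurable (f a)) (hf0 : ∀ a y, 0 ≤ f a y) :
    condEntropy p (fun a => ν.withDensity fun y => ENNReal.ofReal (f a y)) =
      (∫ y, weightEntropy (fun a => (p a).toReal * f a y) ∂ν) / Real.log 2 := by
  have hg0 : ∀ b y, 0 ≤ (p b).toReal * f b y := fun b y =>
    mul_nonneg ENNReal.toReal_nonneg (hf0 b y)
  have hsm : Measurable fun y => ∑ b, (p b).toReal * f b y :=
    Finset.measurable_fun_sum _ fun b _ => (hf b).const_mul _
  rw [condEntropy, outputLaw_withDensity p hf hf0]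
  have hae : (fun y => ∑ a, Real.negMulLog (posteriorProb p
      (fun a => ν.withDensity fun y => ENNReal.ofReal (f a y)) a y) / Real.log 2)
      =ᵐ[ν.withDensity fun y => ENNReal.ofReal (∑ a, (p a).toReal * f a y)]
      fun y => ∑ a, Real.negMulLog ((p a).toReal * f a y / ∑ b, (p b).toReal * f b y) /
        Real.log 2 := by
    have := ae_all_iff.mpr fun a => posteriorProb_withDensity p (ν := ν) hf hf0 a
    filter_upwards [this] with y hy
    exact Finset.sum_congr rfl fun a _ => by rw [hy a]
  rw [integral_congr_ae hae, integral_withDensity_eq_integral_toReal_smul hsm.ennreal_ofReal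
    (Eventually.of_forall fun _ => ENNReal.ofReal_lt_top), ← integral_div]
  refine integral_congr_ae (Eventually.of_forall fun y => ?_)
  simp only [smul_eq_mul]
  rw [ENNReal.toReal_ofReal (Finset.sum_nonneg fun b _ => hg0 b y), ← Finset.sum_div,
    ← mul_div_assoc, sum_mul_sum_negMulLog_div fun a => hg0 a y]

end Density

/-- It suffices to compare boxes, where the integral of the product density factors because the
coordinates are independent. -/
theorem pi_withDensity {ι : Type*} [Fintype ι] {E : ι → Type*} [∀ k, MeasurableSpace (E k)]
    (ν : ∀ k, Measure (E k)) [∀ k, IsProbabilityMeasure (ν k)] {f : ∀ k, E k → ℝ≥0∞}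
    (hf : ∀ k, Measurable (f k)) [∀ k, SigmaFinite ((ν k).withDensity (f k))] :
    Measure.pi (fun k => (ν k).withDensity (f k)) =
      (Measure.pi ν).withDensity fun y => ∏ k, f k (y k) := by
  refine Measure.pi_eq fun s hs => ?_
  rw [withDensity_apply _ (MeasurableSet.univ_pi hs),
    ← lintegral_indicator (MeasurableSet.univ_pi hs)]
  have : ∀ y : ∀ k, E k, (univ.pi s).indicator (fun y => ∏ k, f k (y k)) y =
      ∏ k, (s k).indicator (f k) (y k) := by
    intro y
    by_cases hy : y ∈ univ.pi s
    · rw [indicator_of_mem hy]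
      exact Finset.prod_congr rfl fun k _ => by rw [indicator_of_mem (hy k (mem_univ k))]
    · rw [indicator_of_notMem hy]
      obtain ⟨k, hk⟩ : ∃ k, y k ∉ s k := by simpa using hy
      exact (Finset.prod_eq_zero (Finset.mem_univ k) (by rw [indicator_of_notMem hk])).symm
  simp_rw [this]
  have hm : ∀ k, Measurable ((s k).indicator (f k)) := fun k => (hf k).indicator (hs k)
  have hind : iIndepFun (fun k (y : ∀ k, E k) => (s k).indicator (f k) (y k)) (Measure.pi ν) :=
    iIndepFun_pi fun k => (hm k).aemeasurable
  rw [lintegral_prod_eq_prod_lintegral_of_indepFun _ _ hind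
    fun k => (hm k).comp (measurable_pi_apply k)]
  refine Finset.prod_congr rfl fun k _ => ?_
  rw [(measurePreserving_eval ν k).lintegral_comp (hm k), lintegral_indicator (hs k),
    withDensity_apply _ (hs k)]

section Observation

variable {N : ℕ} {ι : Type*} [Fintype ι]

/-- The likelihood of the soft bits `d` of all observations given the input vector `x`. -/
noncomputable def vectorLikelihood (σ : ι → Fin N) (x : Fin N → ℤˣ) (d : ι → SoftBit) : ℝ :=
  ∏ k, likelihood (x (σ k)) (d k)

theorem vectorLikelihood_nonneg (σ : ι → Fin N) (x : Fin N → ℤˣ) (d : ι → SoftBit) :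
    0 ≤ vectorLikelihood σ x d :=
  Finset.prod_nonneg fun _ _ => likelihood_nonneg _ _

theorem measurable_vectorLikelihood (σ : ι → Fin N) (x : Fin N → ℤˣ) :
    Measurable (vectorLikelihood σ x) :=
  Finset.measurable_fun_prod _ fun k _ => (measurable_likelihood _).comp (measurable_pi_apply k)

/-- The joint law of the soft bits of all observations, for independent uniform inputs. -/
noncomputable def softLawPi (W : ℝ → BMSChannel) (τ : ι → ℝ) : Measure (ι → SoftBit) :=
  Measure.pi fun k => (W (τ k)).softLaw

instance isProbabilityMeasure_softLawPi (W : ℝ → BMSChannel) (τ : ι → ℝ) :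
    IsProbabilityMeasure (softLawPi W τ) := by
  unfold softLawPi; infer_instance

theorem observationLaw_eq_withDensity (W : ℝ → BMSChannel) (σ : ι → Fin N) (τ : ι → ℝ)
    (x : Fin N → ℤˣ) :
    observationLaw W σ τ x = (Measure.pi fun k => (W (τ k)).mixture).withDensity fun y =>
      ENNReal.ofReal (vectorLikelihood σ x fun k => (W (τ k)).softBit (y k)) := by
  have h1 : (fun k => (W (τ k)).law (x (σ k))) = fun k => (W (τ k)).mixture.withDensity
      fun y => ENNReal.ofReal (likelihood (x (σ k)) ((W (τ k)).softBit y)) :=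
    funext fun k => (W (τ k)).law_eq_withDensity _
  have : ∀ k, SigmaFinite ((W (τ k)).mixture.withDensity
      fun y => ENNReal.ofReal (likelihood (x (σ k)) ((W (τ k)).softBit y))) := fun k => by
    rw [← BMSChannel.law_eq_withDensity]; infer_instance
  rw [observationLaw, h1, pi_withDensity _ fun k => (W (τ k)).measurable_density _]
  congr 1
  ext y
  rw [vectorLikelihood, ENNReal.ofReal_prod_of_nonneg fun _ _ => likelihood_nonneg _ _]

/-- The joint weights of the input vectors at the soft bits `d`. -/
noncomputable def jointWeight (p : PMF (Fin N → ℤˣ)) (σ : ι → Fin N) (d : ι → SoftBit)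
    (x : Fin N → ℤˣ) : ℝ :=
  (p x).toReal * vectorLikelihood σ x d

theorem measurable_jointWeight (p : PMF (Fin N → ℤˣ)) (σ : ι → Fin N) :
    Measurable (jointWeight p σ) :=
  measurable_pi_lambda _ fun x => (measurable_vectorLikelihood σ x).const_mul _

theorem measurable_weightEntropy_jointWeight (p : PMF (Fin N → ℤˣ)) (σ : ι → Fin N) :
    Measurable fun d => weightEntropy (jointWeight p σ d) :=
  continuous_weightEntropy.measurable.comp (measurable_jointWeight p σ)

/-- The likelihoods depend on the outputs only through the soft bits. The integrand therefore no
longer involves the channels, which enter only through the product law. -/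
theorem condEntropy_observationLaw (p : PMF (Fin N → ℤˣ)) (W : ℝ → BMSChannel) (σ : ι → Fin N)
    (τ : ι → ℝ) : condEntropy p (observationLaw W σ τ) =
      (∫ d, weightEntropy (jointWeight p σ d) ∂softLawPi W τ) / Real.log 2 := by
  have hm : Measurable fun (y : ι → EReal) k => (W (τ k)).softBit (y k) :=
    measurable_pi_lambda _ fun k =>
      (W (τ k)).measurable_softBit.comp (measurable_pi_apply k)
  have h1 : observationLaw W σ τ = fun x => (Measure.pi fun k => (W (τ k)).mixture).withDensity
      fun y => ENNReal.ofReal (vectorLikelihood σ x fun k => (W (τ k)).softBit (y k)) :=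
    funext fun x => observationLaw_eq_withDensity W σ τ x
  rw [h1, condEntropy_withDensity p (f := fun x (y : ι → EReal) => vectorLikelihood σ x fun k =>
    (W (τ k)).softBit (y k)) (fun x => (measurable_vectorLikelihood σ x).comp hm)
    fun x y => vectorLikelihood_nonneg _ _ _]
  congr 1
  have h2 : softLawPi W τ = (Measure.pi fun k => (W (τ k)).mixture).map
      fun (y : ι → EReal) k => (W (τ k)).softBit (y k) := by
    have : ∀ k, SigmaFinite ((W (τ k)).mixture.map (W (τ k)).softBit) := fun k =>
      inferInstanceAs (SigmaFinite (W (τ k)).softLaw)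
    rw [Measure.pi_map_pi fun k => (W (τ k)).measurable_softBit.aemeasurable]
    rfl
  rw [h2, integral_map hm.aemeasurable
    (measurable_weightEntropy_jointWeight p σ).aestronglyMeasurable]
  rfl

end Observation

theorem channelEntropy_eq_integral (W : ℝ → BMSChannel) (t : ℝ) :
    channelEntropy W t =
      (∫ d, weightEntropy (fun x => 2⁻¹ * likelihood x d) ∂(W t).softLaw) / Real.log 2 := by
  have h1 : (W t).law = fun x => (W t).mixture.withDensity
      fun y => ENNReal.ofReal (likelihood x ((W t).softBit y)) :=
    funext fun x => (W t).law_eq_withDensity x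
  have hp : ∀ x, (PMF.uniformOfFintype ℤˣ x).toReal = 2⁻¹ := by simp
  rw [channelEntropy, h1, condEntropy_withDensity _ (f := fun x y => likelihood x
    ((W t).softBit y)) (fun x => (measurable_likelihood x).comp (W t).measurable_softBit)
    fun x y => likelihood_nonneg _ _]
  simp_rw [hp]
  congr 1
  exact (BMSChannel.integral_softLaw _ (f := fun d => weightEntropy fun x => 2⁻¹ * likelihood x d)
    (continuous_weightEntropy.measurable.comp
      (measurable_pi_lambda _ fun x => (measurable_likelihood x).const_mul _))).symm

/-! ### Power series of the binary entropy -/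

/-- The coefficients of the power series of the binary entropy function around `1/2`. -/
noncomputable def entropyCoeff (n : ℕ) : ℝ := 1 / ((2 * n + 1) * (2 * n + 2))

theorem entropyCoeff_pos (n : ℕ) : 0 < entropyCoeff n := by
  unfold entropyCoeff; positivity

theorem summable_entropyCoeff : Summable entropyCoeff := by
  have h : Summable fun n : ℕ => 1 / ((n + 1 : ℕ) : ℝ) ^ 2 :=
    (summable_nat_add_iff (f := fun n : ℕ => 1 / (n : ℝ) ^ 2) 1).mpr
      (Real.summable_one_div_nat_pow.mpr (by norm_num))
  refine Summable.of_nonneg_of_le (fun n => (entropyCoeff_pos n).le) (fun n => ?_) h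
  unfold entropyCoeff
  push_cast
  refine one_div_le_one_div_of_le (by positivity) ?_
  have : (0 : ℝ) ≤ n := n.cast_nonneg
  nlinarith

/-- The symmetrized function `x ↦ negMulLog (1 + x)`. -/
noncomputable def symmNegMulLog (x : ℝ) : ℝ :=
  (Real.negMulLog (1 + x) + Real.negMulLog (1 - x)) / 2

/-- Write `-symmNegMulLog x` as half of `x (log (1 + x) - log (1 - x)) + log (1 - x²)`. The two
logarithmic series combine to the coefficient `1/(2n+1) - 1/(2n+2)`. -/
theorem hasSum_symmNegMulLog_of_abs_lt_one {x : ℝ} (hx : |x| < 1) :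
    HasSum (fun n : ℕ => entropyCoeff n * x ^ (2 * n + 2)) (-symmNegMulLog x) := by
  have h1 := (Real.hasSum_log_sub_log_of_abs_lt_one hx).mul_left x
  have hx2 : |x ^ 2| < 1 := by rw [abs_pow]; exact pow_lt_one₀ (abs_nonneg x) hx two_ne_zero
  have h2 := Real.hasSum_pow_div_log_of_abs_lt_one hx2
  have h3 := (h1.sub h2).div_const 2
  have hb := abs_lt.mp hx
  have hlog : Real.log (1 - x ^ 2) = Real.log (1 + x) + Real.log (1 - x) := by
    rw [← Real.log_mul (by linarith) (by linarith)]; congr 1; ring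
  have hval : (x * (Real.log (1 + x) - Real.log (1 - x)) - -Real.log (1 - x ^ 2)) / 2 =
      -symmNegMulLog x := by
    rw [hlog, symmNegMulLog, Real.negMulLog, Real.negMulLog]; ring
  rw [hval] at h3
  refine h3.congr_fun fun n => ?_
  unfold entropyCoeff
  have : (0 : ℝ) ≤ n := n.cast_nonneg
  field_simp
  ring

/-- The endpoints `±1`, which occur as soft bits of a perfect channel, follow by continuity since
the series converges uniformly on `[-1,1]`. -/
theorem hasSum_symmNegMulLog {x : ℝ} (hx : |x| ≤ 1) :
    HasSum (fun n : ℕ => entropyCoeff n * x ^ (2 * n + 2)) (-symmNegMulLog x) := by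
  have hbound : ∀ (n : ℕ), ∀ y ∈ Icc (-1 : ℝ) 1,
      ‖entropyCoeff n * y ^ (2 * n + 2)‖ ≤ entropyCoeff n := by
    intro n y hy
    rw [norm_mul, norm_pow, Real.norm_of_nonneg (entropyCoeff_pos n).le]
    exact mul_le_of_le_one_right (entropyCoeff_pos n).le
      (pow_le_one₀ (norm_nonneg _) (abs_le.mpr hy))
  have hc : ContinuousOn (fun y : ℝ => ∑' n : ℕ, entropyCoeff n * y ^ (2 * n + 2))
      (Icc (-1) 1) :=
    continuousOn_tsum (fun n => by fun_prop) summable_entropyCoeff hbound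
  have hc' : ContinuousOn (fun y : ℝ => -symmNegMulLog y) (Icc (-1) 1) := by
    unfold symmNegMulLog; fun_prop
  have heq : EqOn (fun y : ℝ => ∑' n : ℕ, entropyCoeff n * y ^ (2 * n + 2))
      (fun y : ℝ => -symmNegMulLog y) (Ioo (-1) 1) := fun y hy =>
    (hasSum_symmNegMulLog_of_abs_lt_one (abs_lt.mpr hy)).tsum_eq
  have := heq.of_subset_closure hc hc' Ioo_subset_Icc_self
    (by rw [closure_Ioo (by norm_num)]) (abs_le.mp hx)
  rw [← show _ = -symmNegMulLog x from this]
  exact (Summable.of_norm_bounded summable_entropyCoeff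
    fun n => hbound n x (abs_le.mp hx)).hasSum

theorem tsum_entropyCoeff : ∑' n, entropyCoeff n = Real.log 2 := by
  have h := hasSum_symmNegMulLog (x := 1) (by simp)
  simp only [one_pow, mul_one] at h
  rw [h.tsum_eq, symmNegMulLog]
  norm_num [Real.negMulLog]
  ring

/-! ### Entropy lost by one more observation -/

section Bias

variable {A : Type*} [Fintype A]

/-- The signed total of the weights. -/
noncomputable def signedSum (ε : A → ℤˣ) (v : A → ℝ) : ℝ := ∑ a, ((ε a : ℤ) : ℝ) * v a

/-- The even moments of the normalized bias of unnormalized weights. -/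
noncomputable def biasMoment (ε : A → ℤˣ) (n : ℕ) (v : A → ℝ) : ℝ :=
  (∑ a, v a) * (signedSum ε v / ∑ a, v a) ^ (2 * n + 2)

theorem abs_signedSum_le (ε : A → ℤˣ) {v : A → ℝ} (hv : ∀ a, 0 ≤ v a) :
    |signedSum ε v| ≤ ∑ a, v a := by
  refine (Finset.abs_sum_le_sum_abs _ _).trans (Finset.sum_le_sum fun a _ => ?_)
  rcases Int.units_eq_one_or (ε a) with h | h <;> simp [h, abs_of_nonneg (hv a)]

theorem abs_bias_le_one (ε : A → ℤˣ) {v : A → ℝ} (hv : ∀ a, 0 ≤ v a) :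
    |signedSum ε v / ∑ a, v a| ≤ 1 := by
  have h0 : 0 ≤ ∑ a, v a := Finset.sum_nonneg fun a _ => hv a
  rw [abs_div, abs_of_nonneg h0]
  exact div_le_one_of_le₀ (abs_signedSum_le ε hv) h0

theorem sum_mul_bias (ε : A → ℤˣ) {v : A → ℝ} (hv : ∀ a, 0 ≤ v a) :
    (∑ a, v a) * (signedSum ε v / ∑ a, v a) = signedSum ε v := by
  rcases eq_or_ne (∑ a, v a) 0 with h | h
  · have := abs_signedSum_le ε hv
    rw [h] at this ⊢
    rw [abs_nonpos_iff.mp this]; simp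
  · field_simp

theorem bias_pow_le_one (ε : A → ℤˣ) {v : A → ℝ} (hv : ∀ a, 0 ≤ v a) (n : ℕ) :
    (signedSum ε v / ∑ a, v a) ^ (2 * n + 2) ≤ 1 := by
  rw [← (show Even (2 * n + 2) from ⟨n + 1, by ring⟩).pow_abs]
  exact pow_le_one₀ (abs_nonneg _) (abs_bias_le_one ε hv)

theorem biasMoment_nonneg (ε : A → ℤˣ) {v : A → ℝ} (hv : ∀ a, 0 ≤ v a) (n : ℕ) :
    0 ≤ biasMoment ε n v :=
  mul_nonneg (Finset.sum_nonneg fun a _ => hv a)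
    ((show Even (2 * n + 2) from ⟨n + 1, by ring⟩).pow_nonneg _)

theorem biasMoment_le (ε : A → ℤˣ) {v : A → ℝ} (hv : ∀ a, 0 ≤ v a) (n : ℕ) :
    biasMoment ε n v ≤ ∑ a, v a :=
  mul_le_of_le_one_right (Finset.sum_nonneg fun a _ => hv a) (bias_pow_le_one ε hv n)

theorem measurable_signedSum (ε : A → ℤˣ) : Measurable (signedSum ε) := by
  unfold signedSum; fun_prop

theorem measurable_biasMoment (ε : A → ℤˣ) (n : ℕ) : Measurable (biasMoment ε n) := by
  have h1 : Measurable fun v : A → ℝ => ∑ a, v a := by fun_prop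
  exact h1.mul (((measurable_signedSum ε).div h1).pow_const _)

/-- The entropy lost by one more observation with soft bit `d`, averaged over `±d`. -/
theorem hasSum_entropy_loss (ε : A → ℤˣ) {q : A → ℝ} (hq : ∀ a, 0 ≤ q a) (d : SoftBit) :
    HasSum (fun n => entropyCoeff n * (d : ℝ) ^ (2 * n + 2) * (∑ a, q a - biasMoment ε n q))
      (weightEntropy q - (weightEntropy (fun a => q a * likelihood (ε a) d) +
        weightEntropy (fun a => q a * likelihood (ε a) d.reflect)) / 2) := by
  set Q := ∑ a, q a with hQ
  set u := signedSum ε q / Q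
  have hu1 : |u| ≤ 1 := abs_bias_le_one ε hq
  have hud : |u * d| ≤ 1 := by
    rw [abs_mul]; exact mul_le_one₀ hu1 (abs_nonneg _) (SoftBit.abs_le_one d)
  have h1 := ((hasSum_symmNegMulLog (SoftBit.abs_le_one d)).sub
    (hasSum_symmNegMulLog hud)).mul_left Q
  have hlik : ∀ (s : ℝ), ∑ a, q a * (1 + ((ε a : ℤ) : ℝ) * s) = Q * (1 + u * s) := by
    intro s
    have : signedSum ε q = Q * u := (sum_mul_bias ε hq).symm
    rw [mul_add, mul_one, ← mul_assoc, ← this, signedSum, Finset.sum_mul, hQ,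
      ← Finset.sum_add_distrib]
    exact Finset.sum_congr rfl fun a _ => by ring
  -- Averaging over `±d` removes the dependence on the sign `ε a`; only the total weight, which
  -- becomes `Q (1 ± u d)`, still feels the bias `u`.
  have hterm : ∀ a, Real.negMulLog (q a * (1 + ((ε a : ℤ) : ℝ) * d)) +
      Real.negMulLog (q a * (1 + ((ε a : ℤ) : ℝ) * -d)) =
      2 * Real.negMulLog (q a) + 2 * symmNegMulLog d * q a := by
    intro a
    rw [Real.negMulLog_mul, Real.negMulLog_mul, symmNegMulLog]
    rcases Int.units_eq_one_or (ε a) with h | h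
    · rw [h]; push_cast; rw [one_mul, one_mul, ← sub_eq_add_neg]; ring
    · rw [h]; push_cast; rw [neg_one_mul, neg_one_mul, neg_neg, ← sub_eq_add_neg]; ring
  have htot : Real.negMulLog (Q * (1 + u * d)) + Real.negMulLog (Q * (1 + u * -d)) =
      2 * Real.negMulLog Q + 2 * Q * symmNegMulLog (u * d) := by
    rw [Real.negMulLog_mul, Real.negMulLog_mul, symmNegMulLog, mul_neg, ← sub_eq_add_neg]; ring
  have hval : weightEntropy q - (weightEntropy (fun a => q a * likelihood (ε a) d) +
        weightEntropy (fun a => q a * likelihood (ε a) d.reflect)) / 2 =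
      Q * (-symmNegMulLog d - -symmNegMulLog (u * d)) := by
    simp only [weightEntropy, likelihood, SoftBit.reflect]
    rw [hlik, hlik]
    have hs := Finset.sum_congr (rfl : (Finset.univ : Finset A) = Finset.univ) fun a _ => hterm a
    rw [Finset.sum_add_distrib, Finset.sum_add_distrib, ← Finset.mul_sum, ← Finset.mul_sum,
      ← hQ] at hs
    linear_combination (-1 / 2 : ℝ) * hs + (1 / 2 : ℝ) * htot
  rw [hval]
  refine h1.congr_fun fun n => ?_
  rw [biasMoment, mul_pow]
  ring

end Bias

/-- The even moments of the soft bit. -/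
noncomputable def BMSChannel.softMoment (V : BMSChannel) (n : ℕ) : ℝ :=
  ∫ d : SoftBit, (d : ℝ) ^ (2 * n + 2) ∂V.softLaw

theorem SoftBit.pow_mem (d : SoftBit) (n : ℕ) : (d : ℝ) ^ (2 * n + 2) ∈ Icc (0 : ℝ) 1 := by
  have he : Even (2 * n + 2) := ⟨n + 1, by ring⟩
  refine ⟨he.pow_nonneg _, ?_⟩
  rw [← he.pow_abs]
  exact pow_le_one₀ (abs_nonneg _) d.abs_le_one

theorem SoftBit.measurable_pow (n : ℕ) : Measurable fun d : SoftBit => (d : ℝ) ^ n :=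
  measurable_subtype_coe.pow_const n

theorem BMSChannel.softMoment_mem (V : BMSChannel) (n : ℕ) : V.softMoment n ∈ Icc (0 : ℝ) 1 := by
  refine ⟨integral_nonneg fun d => (d.pow_mem n).1, ?_⟩
  have : ∫ d : SoftBit, (d : ℝ) ^ (2 * n + 2) ∂V.softLaw ≤ ∫ _ : SoftBit, (1 : ℝ) ∂V.softLaw :=
    integral_mono (integrable_of_abs_le (SoftBit.measurable_pow _) (C := 1) fun d => by
      rw [abs_of_nonneg (d.pow_mem n).1]; exact (d.pow_mem n).2) (integrable_const _)
      fun d => (d.pow_mem n).2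
  simpa [softMoment] using this

theorem exists_bound_weightEntropy (A : Type*) [Fintype A] (C : ℝ) :
    ∃ B, ∀ v : A → ℝ, (∀ a, 0 ≤ v a) → (∀ a, v a ≤ C) → |weightEntropy v| ≤ B := by
  obtain ⟨B, hB⟩ :=
    (isCompact_Icc (a := (0 : A → ℝ)) (b := fun _ => C)).exists_bound_of_continuousOn
    continuous_weightEntropy.continuousOn
  exact ⟨B, fun v h0 h1 => hB v ⟨h0, h1⟩⟩

/-- The entropy lost by one more observation through `V`, expanded in the soft moments of `V`. -/
theorem hasSum_integral_entropy_loss {A X : Type*} [Fintype A] [MeasurableSpace X]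
    (P : Measure X) [IsProbabilityMeasure P] (V : BMSChannel) (ε : A → ℤˣ) {q : X → A → ℝ}
    (hqm : Measurable q) {C : ℝ} (hq0 : ∀ x a, 0 ≤ q x a) (hqC : ∀ x a, q x a ≤ C) :
    HasSum (fun n => entropyCoeff n * V.softMoment n *
        ∫ x, (∑ a, q x a - biasMoment ε n (q x)) ∂P)
      (∫ x, weightEntropy (q x) ∂P -
        ∫ z, weightEntropy (fun a => q z.1 a * likelihood (ε a) z.2) ∂P.prod V.softLaw) := by
  have hsum_m : Measurable fun x => ∑ a, q x a := by fun_prop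
  have hR0 : ∀ n x, 0 ≤ ∑ a, q x a - biasMoment ε n (q x) := fun n x =>
    sub_nonneg.mpr (biasMoment_le ε (hq0 x) n)
  have hRC : ∀ n x, ∑ a, q x a - biasMoment ε n (q x) ≤ Fintype.card A * C := fun n x => by
    have h1 := biasMoment_nonneg ε (hq0 x) n
    have h2 : ∑ a, q x a ≤ ∑ _a : A, C := Finset.sum_le_sum fun a _ => hqC x a
    rw [Finset.sum_const, Finset.card_univ, nsmul_eq_mul] at h2
    linarith
  have hRm : ∀ n, Measurable fun x => ∑ a, q x a - biasMoment ε n (q x) := fun n =>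
    hsum_m.sub ((measurable_biasMoment ε n).comp hqm)
  have hRi : ∀ n, Integrable (fun x => ∑ a, q x a - biasMoment ε n (q x)) P := fun n =>
    integrable_of_abs_le (hRm n) fun x => by rw [abs_of_nonneg (hR0 n x)]; exact hRC n x
  have hDi : ∀ n, Integrable (fun d : SoftBit => (d : ℝ) ^ (2 * n + 2)) V.softLaw := fun n =>
    integrable_of_abs_le (SoftBit.measurable_pow _) (C := 1) fun d => by
      rw [abs_of_nonneg (d.pow_mem n).1]; exact (d.pow_mem n).2
  set F : ℕ → X × SoftBit → ℝ := fun n z => entropyCoeff n * (z.2 : ℝ) ^ (2 * n + 2) *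
    (∑ a, q z.1 a - biasMoment ε n (q z.1))
  have hF_eq : ∀ n z, F n z = (∑ a, q z.1 a - biasMoment ε n (q z.1)) *
      (entropyCoeff n * (z.2 : ℝ) ^ (2 * n + 2)) := fun n z => mul_comm _ _
  have hF0 : ∀ n z, 0 ≤ F n z := fun n z =>
    mul_nonneg (mul_nonneg (entropyCoeff_pos n).le (z.2.pow_mem n).1) (hR0 n z.1)
  have hFi : ∀ n, Integrable (F n) (P.prod V.softLaw) := fun n => by
    simp_rw [funext (hF_eq n)]
    exact (hRi n).mul_prod ((hDi n).const_mul _)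
  have hF_int : ∀ n, ∫ z, F n z ∂P.prod V.softLaw = entropyCoeff n * V.softMoment n *
      ∫ x, (∑ a, q x a - biasMoment ε n (q x)) ∂P := fun n => by
    simp_rw [hF_eq]
    rw [integral_prod_mul (fun x => ∑ a, q x a - biasMoment ε n (q x))
      (fun d : SoftBit => entropyCoeff n * (d : ℝ) ^ (2 * n + 2)), integral_const_mul,
      BMSChannel.softMoment]
    ring
  have hF_norm : Summable fun n => ∫ z, ‖F n z‖ ∂P.prod V.softLaw := by
    simp_rw [fun n z => Real.norm_of_nonneg (hF0 n z), hF_int]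
    refine Summable.of_nonneg_of_le (fun n => mul_nonneg (mul_nonneg (entropyCoeff_pos n).le
      (V.softMoment_mem n).1) (integral_nonneg (hR0 n))) (fun n => ?_)
      (summable_entropyCoeff.mul_right (Fintype.card A * C))
    refine mul_le_mul (mul_le_of_le_one_right (entropyCoeff_pos n).le (V.softMoment_mem n).2) ?_
      (integral_nonneg (hR0 n)) (entropyCoeff_pos n).le
    have := integral_mono (hRi n) (integrable_const (μ := P) (Fintype.card A * C)) (hRC n)
    simpa using this
  have hmain := hasSum_integral_of_summable_integral_norm hFi hF_norm
  simp_rw [hF_int] at hmain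
  refine Eq.subst (motive := fun v => HasSum _ v) ?_ hmain
  have hG : ∀ z : X × SoftBit, ∑' n, F n z = weightEntropy (q z.1) -
      (weightEntropy (fun a => q z.1 a * likelihood (ε a) z.2) +
        weightEntropy (fun a => q z.1 a * likelihood (ε a) z.2.reflect)) / 2 := fun z =>
    (hasSum_entropy_loss ε (hq0 z.1) z.2).tsum_eq
  refine (integral_congr_ae (Eventually.of_forall hG)).trans ?_
  obtain ⟨B, hB⟩ := exists_bound_weightEntropy A (C * 2)
  obtain ⟨B', hB'⟩ := exists_bound_weightEntropy A C
  have hGm : Measurable fun z : X × SoftBit =>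
      weightEntropy (fun a => q z.1 a * likelihood (ε a) z.2) := by
    refine continuous_weightEntropy.measurable.comp (measurable_pi_lambda _ fun a => ?_)
    exact ((measurable_pi_apply a).comp (hqm.comp measurable_fst)).mul
      ((measurable_likelihood (ε a)).comp measurable_snd)
  have hGb : ∀ z : X × SoftBit,
      |weightEntropy (fun a => q z.1 a * likelihood (ε a) z.2)| ≤ B := fun z =>
    hB _ (fun a => mul_nonneg (hq0 _ _) (likelihood_nonneg _ _)) fun a =>
      mul_le_mul (hqC _ _) (likelihood_le_two _ _) (likelihood_nonneg _ _)
        ((hq0 z.1 a).trans (hqC z.1 a))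
  -- Reflection invariance of the soft law makes the average over `±d` in the pointwise expansion
  -- harmless.
  have hmp : MeasurePreserving (Prod.map id SoftBit.reflect : X × SoftBit → X × SoftBit)
      (P.prod V.softLaw) (P.prod V.softLaw) :=
    (MeasurePreserving.id P).prod V.measurePreserving_reflect
  have i1 : Integrable (fun z : X × SoftBit =>
      weightEntropy (fun a => q z.1 a * likelihood (ε a) z.2)) (P.prod V.softLaw) :=
    integrable_of_abs_le hGm hGb
  have i2 : Integrable (fun z : X × SoftBit =>
      weightEntropy (fun a => q z.1 a * likelihood (ε a) z.2.reflect)) (P.prod V.softLaw) :=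
    integrable_of_abs_le (hGm.comp hmp.measurable) fun z => hGb (z.1, z.2.reflect)
  have hqE : Measurable fun x => weightEntropy (q x) :=
    continuous_weightEntropy.measurable.comp hqm
  have i0 : Integrable (fun z : X × SoftBit => weightEntropy (q z.1)) (P.prod V.softLaw) :=
    integrable_of_abs_le (hqE.comp measurable_fst) fun z => hB' _ (hq0 _) (hqC _)
  have e2 : ∫ z, weightEntropy (fun a => q z.1 a * likelihood (ε a) z.2.reflect)
        ∂P.prod V.softLaw =
      ∫ z, weightEntropy (fun a => q z.1 a * likelihood (ε a) z.2) ∂P.prod V.softLaw := by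
    conv_rhs => rw [← hmp.map_eq]
    rw [integral_map hmp.measurable.aemeasurable hGm.aestronglyMeasurable]
    rfl
  have e0 : ∫ z, weightEntropy (q z.1) ∂P.prod V.softLaw = ∫ x, weightEntropy (q x) ∂P := by
    rw [integral_fun_fst (fun x => weightEntropy (q x))]; simp
  rw [integral_sub i0 ((i1.fun_add i2).div_const 2), integral_div, integral_add i1 i2, e2, e0]
  ring

/-! ### Convexity of the bias moments -/

/-- The soft bit of an erased observation. -/
def SoftBit.zero : SoftBit := ⟨0, by norm_num, by norm_num⟩

theorem likelihood_zero (x : ℤˣ) : likelihood x SoftBit.zero = 1 := by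
  simp [likelihood, SoftBit.zero]

/-- The tangent line of an even power at `y`: after division by `y ^ (2 * n + 2)` it is Bernoulli's
inequality for `|x / y|`. -/
theorem even_pow_tangent (n : ℕ) (x y : ℝ) :
    (2 * n + 2) * y ^ (2 * n + 1) * x - (2 * n + 1) * y ^ (2 * n + 2) ≤ x ^ (2 * n + 2) := by
  have he : Even (2 * n + 2) := ⟨n + 1, by ring⟩
  rcases eq_or_ne y 0 with rfl | hy
  · simpa using he.pow_nonneg x
  · have hb := one_add_mul_le_pow (a := |x / y| - 1) (by linarith [abs_nonneg (x / y)]) (2 * n + 2)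
    rw [add_sub_cancel, he.pow_abs] at hb
    have hr : x / y ≤ |x / y| := le_abs_self _
    have h1 : 1 + (2 * n + 2) * (x / y - 1) ≤ (x / y) ^ (2 * n + 2) := by
      push_cast at hb
      have : (0 : ℝ) ≤ 2 * n + 2 := by positivity
      nlinarith
    have h2 := mul_le_mul_of_nonneg_right h1 (he.pow_nonneg y)
    rw [← mul_pow, div_mul_cancel₀ x hy] at h2
    refine le_trans (le_of_eq ?_) h2
    field_simp
    ring

section Bias

variable {A : Type*} [Fintype A]

/-- The left side is linear in `v`. With equality when `u` is the bias of `v`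
(`biasMoment_eq_tangent`), this exhibits the bias moment as a supremum of linear functions, hence as
convex in the weights. -/
theorem biasMoment_tangent (ε : A → ℤˣ) {v : A → ℝ} (hv : ∀ a, 0 ≤ v a) (n : ℕ) (u : ℝ) :
    (2 * n + 2) * u ^ (2 * n + 1) * signedSum ε v - (2 * n + 1) * u ^ (2 * n + 2) * ∑ a, v a ≤
      biasMoment ε n v := by
  have h := mul_le_mul_of_nonneg_left
    (even_pow_tangent n (signedSum ε v / ∑ a, v a) u)
    (Finset.sum_nonneg fun a _ => hv a : 0 ≤ ∑ a, v a)
  rw [biasMoment]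
  refine le_trans (le_of_eq ?_) h
  rw [mul_sub, mul_left_comm, sum_mul_bias ε hv]
  ring

theorem biasMoment_eq_tangent (ε : A → ℤˣ) {v : A → ℝ} (hv : ∀ a, 0 ≤ v a) (n : ℕ) :
    biasMoment ε n v =
      (2 * n + 2) * (signedSum ε v / ∑ a, v a) ^ (2 * n + 1) * signedSum ε v -
        (2 * n + 1) * (signedSum ε v / ∑ a, v a) ^ (2 * n + 2) * ∑ a, v a := by
  rw [biasMoment]
  nth_rw 3 [← sum_mul_bias ε hv]
  ring

/-- Bias moments are convex along affine families of weights: a bounded measurable subgradient. -/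
theorem exists_subgradient_biasMoment (ε : A → ℤˣ) (n : ℕ) {v : SoftBit → A → ℝ} {α β : A → ℝ}
    (hv : ∀ e a, v e a = α a + β a * e) (hv0 : ∀ e a, 0 ≤ v e a) :
    ∃ (g : SoftBit → ℝ) (C : ℝ), Measurable g ∧ (∀ e, |g e| ≤ C) ∧
      (∀ e, |biasMoment ε n (v e)| ≤ C) ∧ Measurable (fun e => biasMoment ε n (v e)) ∧
      ∀ e e₀ : SoftBit, biasMoment ε n (v e₀) + g e₀ * (e - e₀) ≤ biasMoment ε n (v e) := by
  have hsum : ∀ e, ∑ a, v e a = ∑ a, α a + (∑ a, β a) * e := fun e => by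
    simp_rw [hv, Finset.sum_add_distrib, Finset.sum_mul]
  have hsgn : ∀ e, signedSum ε (v e) = signedSum ε α + signedSum ε β * e := fun e => by
    simp only [signedSum, hv, Finset.sum_mul, ← Finset.sum_add_distrib]
    exact Finset.sum_congr rfl fun a _ => by ring
  have hvm : Measurable v := measurable_pi_lambda _ fun a => by
    simp_rw [hv]; exact (measurable_subtype_coe.const_mul _).const_add _
  have hum : Measurable fun e => signedSum ε (v e) / ∑ a, v e a :=
    ((measurable_signedSum ε).comp hvm).div (by fun_prop)
  have hu : ∀ e, |signedSum ε (v e) / ∑ a, v e a| ≤ 1 := fun e => abs_bias_le_one ε (hv0 e)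
  refine ⟨fun e => (2 * n + 2) * (signedSum ε (v e) / ∑ a, v e a) ^ (2 * n + 1) *
      signedSum ε β - (2 * n + 1) * (signedSum ε (v e) / ∑ a, v e a) ^ (2 * n + 2) * ∑ a, β a,
    (2 * n + 2) * |signedSum ε β| + (2 * n + 1) * |∑ a, β a| + (|∑ a, α a| + |∑ a, β a|),
    ?_, fun e => ?_, fun e => ?_, (measurable_biasMoment ε n).comp hvm, fun e e₀ => ?_⟩
  · exact (((hum.pow_const _).const_mul _).mul_const _).sub
      (((hum.pow_const _).const_mul _).mul_const _)
  · have hn : (0 : ℝ) ≤ n := n.cast_nonneg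
    have hp : ∀ j, |(signedSum ε (v e) / ∑ a, v e a) ^ j| ≤ 1 := fun j => by
      rw [abs_pow]; exact pow_le_one₀ (abs_nonneg _) (hu e)
    refine (abs_sub _ _).trans ?_
    rw [abs_mul, abs_mul, abs_mul, abs_mul, abs_of_nonneg (by positivity : (0 : ℝ) ≤ 2 * n + 2),
      abs_of_nonneg (by positivity : (0 : ℝ) ≤ 2 * n + 1)]
    have h1 : (2 * n + 2) * |(signedSum ε (v e) / ∑ a, v e a) ^ (2 * n + 1)| * |signedSum ε β| ≤
        (2 * n + 2) * |signedSum ε β| :=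
      mul_le_mul_of_nonneg_right (mul_le_of_le_one_right (by positivity) (hp _)) (abs_nonneg _)
    have h2 : (2 * n + 1) * |(signedSum ε (v e) / ∑ a, v e a) ^ (2 * n + 2)| * |∑ a, β a| ≤
        (2 * n + 1) * |∑ a, β a| :=
      mul_le_mul_of_nonneg_right (mul_le_of_le_one_right (by positivity) (hp _)) (abs_nonneg _)
    linarith [abs_nonneg (∑ a, α a), abs_nonneg (∑ a, β a)]
  · rw [abs_of_nonneg (biasMoment_nonneg ε (hv0 e) n)]
    refine (biasMoment_le ε (hv0 e) n).trans ?_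
    rw [hsum]
    have h1 : (∑ a, β a) * e ≤ |∑ a, β a| := by
      refine (le_abs_self _).trans ?_
      rw [abs_mul]; exact mul_le_of_le_one_right (abs_nonneg _) e.abs_le_one
    have : 0 ≤ (2 * (n : ℝ) + 2) * |signedSum ε β| + (2 * n + 1) * |∑ a, β a| := by positivity
    linarith [le_abs_self (∑ a, α a)]
  · have h1 := biasMoment_tangent ε (hv0 e) n (signedSum ε (v e₀) / ∑ a, v e₀ a)
    have h2 := biasMoment_eq_tangent ε (hv0 e₀) n
    refine le_trans (le_of_eq ?_) h1
    rw [h2]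
    dsimp only
    generalize signedSum ε (v e₀) / ∑ a, v e₀ a = u
    rw [hsgn, hsgn, hsum, hsum]
    ring

end Bias

theorem measurable_update_softBit {ι : Type*} [DecidableEq ι] (k : ι) :
    Measurable fun z : (ι → SoftBit) × SoftBit => Function.update z.1 k z.2 := by
  refine measurable_pi_lambda _ fun l => ?_
  by_cases h : l = k
  · subst h; simpa using measurable_snd
  · simp only [Function.update_of_ne h]
    exact (measurable_pi_apply l).comp measurable_fst

/-! ### Extrinsic moments and their monotonicity under degradation -/

section Experiment

variable {N : ℕ} {ι : Type*} [Fintype ι]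

theorem jointWeight_nonneg (p : PMF (Fin N → ℤˣ)) (σ : ι → Fin N) (d : ι → SoftBit)
    (x : Fin N → ℤˣ) : 0 ≤ jointWeight p σ d x :=
  mul_nonneg ENNReal.toReal_nonneg (vectorLikelihood_nonneg _ _ _)

theorem jointWeight_le (p : PMF (Fin N → ℤˣ)) (σ : ι → Fin N) (d : ι → SoftBit)
    (x : Fin N → ℤˣ) : jointWeight p σ d x ≤ 2 ^ Fintype.card ι := by
  have h1 : (p x).toReal ≤ 1 :=
    ENNReal.toReal_le_of_le_ofReal zero_le_one (by simpa using p.coe_le_one x)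
  have h2 : vectorLikelihood σ x d ≤ 2 ^ Fintype.card ι := by
    have := Finset.prod_le_prod (s := Finset.univ) (f := fun k => likelihood (x (σ k)) (d k))
      (g := fun _ => 2) (fun k _ => likelihood_nonneg _ _) (fun k _ => likelihood_le_two _ _)
    simpa [vectorLikelihood] using this
  exact (mul_le_of_le_one_left (vectorLikelihood_nonneg _ _ _) h1).trans h2

variable [DecidableEq ι]

theorem jointWeight_update (p : PMF (Fin N → ℤˣ)) (σ : ι → Fin N) (d : ι → SoftBit) (k : ι)
    (e : SoftBit) (x : Fin N → ℤˣ) : jointWeight p σ (Function.update d k e) x =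
      jointWeight p σ (Function.update d k SoftBit.zero) x * likelihood (x (σ k)) e := by
  have h : ∀ e', vectorLikelihood σ x (Function.update d k e') = likelihood (x (σ k)) e' *
      ∏ l ∈ Finset.univ.erase k, likelihood (x (σ l)) (d l) := by
    intro e'
    rw [vectorLikelihood, ← Finset.mul_prod_erase _ _ (Finset.mem_univ k), Function.update_self]
    congr 1
    refine Finset.prod_congr rfl fun l hl => ?_
    rw [Function.update_of_ne (Finset.ne_of_mem_erase hl)]
  rw [jointWeight, jointWeight, h e, h SoftBit.zero, likelihood_zero]
  ring

/-- Resampling one observation through another channel. -/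
theorem measurePreserving_update (W : ℝ → BMSChannel) (τ : ι → ℝ) (k : ι) (s : ℝ) :
    MeasurePreserving (fun z : (ι → SoftBit) × SoftBit => Function.update z.1 k z.2)
      ((softLawPi W τ).prod (W s).softLaw) (softLawPi W (Function.update τ k s)) := by
  refine ⟨measurable_update_softBit k, ?_⟩
  refine (Measure.pi_eq fun S hS => ?_).symm
  rw [Measure.map_apply (measurable_update_softBit k) (MeasurableSet.univ_pi hS)]
  have : (fun z : (ι → SoftBit) × SoftBit => Function.update z.1 k z.2) ⁻¹' univ.pi S =
      (univ.pi (Function.update S k univ)) ×ˢ S k := by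
    ext z
    simp only [mem_preimage, Set.mem_pi, mem_univ, true_imp_iff, mem_prod]
    constructor
    · intro h
      refine ⟨fun l => ?_, by simpa using h k⟩
      by_cases hl : l = k
      · subst hl; simp
      · simpa [Function.update_of_ne hl] using h l
    · rintro ⟨h1, h2⟩ l
      by_cases hl : l = k
      · subst hl; simpa using h2
      · simpa [Function.update_of_ne hl] using h1 l
  rw [this, Measure.prod_prod, softLawPi, Measure.pi_pi, mul_comm,
    ← Finset.mul_prod_erase _ _ (Finset.mem_univ k),
    ← Finset.mul_prod_erase _ _ (Finset.mem_univ k)]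
  simp only [Function.update_self, measure_univ, one_mul]
  congr 1
  refine Finset.prod_congr rfl fun l hl => ?_
  have hl' := Finset.ne_of_mem_erase hl
  simp [Function.update_of_ne hl']

/-- The joint weights when observation `k` is erased. -/
noncomputable def extrinsicWeight (p : PMF (Fin N → ℤˣ)) (σ : ι → Fin N) (k : ι)
    (d : ι → SoftBit) : (Fin N → ℤˣ) → ℝ :=
  jointWeight p σ (Function.update d k SoftBit.zero)

theorem measurable_extrinsicWeight (p : PMF (Fin N → ℤˣ)) (σ : ι → Fin N) (k : ι) :
    Measurable (extrinsicWeight p σ k) :=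
  (measurable_jointWeight p σ).comp
    ((measurable_update_softBit k).comp (measurable_id.prodMk measurable_const))

/-- The bias moment of the input bit seen by observation `k`, when that observation is erased. -/
noncomputable def extrinsicBias (p : PMF (Fin N → ℤˣ)) (σ : ι → Fin N) (k : ι) (n : ℕ)
    (d : ι → SoftBit) : ℝ :=
  biasMoment (fun x => x (σ k)) n (extrinsicWeight p σ k d)

/-- The extrinsic bias moment of the input bit seen by observation `k`. -/
noncomputable def extrinsicMoment (p : PMF (Fin N → ℤˣ)) (W : ℝ → BMSChannel) (σ : ι → Fin N)
    (k : ι) (τ : ι → ℝ) (n : ℕ) : ℝ :=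
  ∫ d, extrinsicBias p σ k n d ∂softLawPi W τ

theorem integral_likelihood (V : BMSChannel) (x : ℤˣ) : ∫ d, likelihood x d ∂V.softLaw = 1 := by
  have hi : Integrable (fun d : SoftBit => (d : ℝ)) V.softLaw :=
    integrable_of_abs_le measurable_subtype_coe SoftBit.abs_le_one
  simp only [likelihood]
  rw [integral_add (integrable_const _) (hi.const_mul _), integral_const_mul,
    V.integral_softLaw_coe]
  simp

theorem integrable_extrinsicWeight (p : PMF (Fin N → ℤˣ)) (W : ℝ → BMSChannel) (σ : ι → Fin N)
    (k : ι) (τ : ι → ℝ) (x : Fin N → ℤˣ) :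
    Integrable (fun d => extrinsicWeight p σ k d x) (softLawPi W τ) :=
  integrable_of_abs_le (C := 2 ^ Fintype.card ι)
    ((measurable_pi_apply x).comp (measurable_extrinsicWeight p σ k)) fun d => by
      rw [extrinsicWeight, abs_of_nonneg (jointWeight_nonneg _ _ _ _)]
      exact jointWeight_le _ _ _ _

theorem integral_sum_extrinsicWeight (p : PMF (Fin N → ℤˣ)) (W : ℝ → BMSChannel)
    (σ : ι → Fin N) (k : ι) (τ : ι → ℝ) :
    ∫ d, ∑ x, extrinsicWeight p σ k d x ∂softLawPi W τ = 1 := by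
  rw [integral_finsetSum _ fun x _ => integrable_extrinsicWeight p W σ k τ x]
  have h : ∀ x, ∫ d, extrinsicWeight p σ k d x ∂softLawPi W τ = (p x).toReal := by
    intro x
    simp only [extrinsicWeight, jointWeight]
    rw [integral_const_mul]
    have hprod : ∀ d : ι → SoftBit, vectorLikelihood σ x (Function.update d k SoftBit.zero) =
        ∏ l, (fun l (e : SoftBit) => if l = k then 1 else likelihood (x (σ l)) e) l (d l) := by
      intro d
      refine Finset.prod_congr rfl fun l _ => ?_
      by_cases hl : l = k
      · subst hl; simp [likelihood_zero]
      · simp [hl]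
    simp_rw [hprod]
    rw [softLawPi, integral_fintype_prod_eq_prod
      (f := fun l (e : SoftBit) => if l = k then 1 else likelihood (x (σ l)) e)]
    rw [Finset.prod_eq_one, mul_one]
    intro l _
    by_cases hl : l = k
    · simp [hl]
    · simp [hl, integral_likelihood]
  simp_rw [h]
  have hp : ∑ x, p x = 1 := by rw [← p.tsum_coe, tsum_fintype]
  rw [← ENNReal.toReal_sum fun x _ => p.apply_ne_top x, hp, ENNReal.toReal_one]

theorem extrinsicBias_mem (p : PMF (Fin N → ℤˣ)) (σ : ι → Fin N) (k : ι) (n : ℕ)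
    (d : ι → SoftBit) : extrinsicBias p σ k n d ∈
      Icc 0 (∑ x, extrinsicWeight p σ k d x) :=
  ⟨biasMoment_nonneg _ (jointWeight_nonneg _ _ _) n, biasMoment_le _ (jointWeight_nonneg _ _ _) n⟩

theorem measurable_extrinsicBias (p : PMF (Fin N → ℤˣ)) (σ : ι → Fin N) (k : ι)
    (n : ℕ) :
    Measurable (extrinsicBias p σ k n) :=
  (measurable_biasMoment _ n).comp (measurable_extrinsicWeight p σ k)

theorem abs_extrinsicBias_le (p : PMF (Fin N → ℤˣ)) (σ : ι → Fin N) (k : ι) (n : ℕ)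
    (d : ι → SoftBit) : |extrinsicBias p σ k n d| ≤
      ∑ _x : Fin N → ℤˣ, (2 : ℝ) ^ Fintype.card ι := by
  have h := extrinsicBias_mem p σ k n d
  rw [abs_of_nonneg h.1]
  exact h.2.trans (Finset.sum_le_sum fun x _ => jointWeight_le _ _ _ _)

theorem integrable_extrinsicBias (p : PMF (Fin N → ℤˣ)) (σ : ι → Fin N) (k : ι) (n : ℕ)
    (μ : Measure (ι → SoftBit)) [IsFiniteMeasure μ] :
    Integrable (fun d => extrinsicBias p σ k n d) μ :=
  integrable_of_abs_le (measurable_extrinsicBias p σ k n)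
    (abs_extrinsicBias_le p σ k n)

theorem extrinsicMoment_mem (p : PMF (Fin N → ℤˣ)) (W : ℝ → BMSChannel) (σ : ι → Fin N)
    (k : ι) (τ : ι → ℝ) (n : ℕ) : extrinsicMoment p W σ k τ n ∈ Icc (0 : ℝ) 1 := by
  refine ⟨integral_nonneg fun d => (extrinsicBias_mem p σ k n d).1, ?_⟩
  rw [← integral_sum_extrinsicWeight p W σ k τ]
  exact integral_mono (integrable_extrinsicBias p σ k n _)
    (integrable_finsetSum _ fun x _ => integrable_extrinsicWeight p W σ k τ x)
    fun d => (extrinsicBias_mem p σ k n d).2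

theorem extrinsicMoment_update (p : PMF (Fin N → ℤˣ)) (W : ℝ → BMSChannel) (σ : ι → Fin N)
    (k l : ι) (τ : ι → ℝ) (s : ℝ) (n : ℕ) :
    extrinsicMoment p W σ k (Function.update τ l s) n =
      ∫ d, ∫ e, extrinsicBias p σ k n (Function.update d l e)
        ∂(W s).softLaw ∂softLawPi W τ := by
  have hmp := measurePreserving_update W τ l s
  rw [extrinsicMoment, ← hmp.map_eq, integral_map hmp.measurable.aemeasurable
    (measurable_extrinsicBias p σ k n).aestronglyMeasurable]
  exact integral_prod (f := fun z : (ι → SoftBit) × SoftBit =>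
    extrinsicBias p σ k n (Function.update z.1 l z.2))
    (integrable_of_abs_le ((measurable_extrinsicBias p σ k n).comp hmp.measurable)
      fun z => abs_extrinsicBias_le p σ k n _)

/-- Likelihoods are affine in each soft bit. For `l = k` the observation is erased, so the slope is
`0`. Convexity of the bias moments in a single soft bit follows. -/
theorem extrinsicWeight_update_affine (p : PMF (Fin N → ℤˣ)) (σ : ι → Fin N) (k l : ι)
    (d : ι → SoftBit) : ∃ α β : (Fin N → ℤˣ) → ℝ, ∀ (e : SoftBit) (x : Fin N → ℤˣ),
      extrinsicWeight p σ k (Function.update d l e) x = α x + β x * e := by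
  by_cases hl : l = k
  · subst hl
    exact ⟨extrinsicWeight p σ l d, 0, fun e x => by simp [extrinsicWeight]⟩
  · refine ⟨jointWeight p σ (Function.update (Function.update d k SoftBit.zero) l SoftBit.zero),
      fun x => jointWeight p σ (Function.update (Function.update d k SoftBit.zero) l
        SoftBit.zero) x * ((x (σ l) : ℤ) : ℝ), fun e x => ?_⟩
    rw [extrinsicWeight, Function.update_comm hl, jointWeight_update, likelihood]
    ring

theorem exists_subgradient_extrinsic (p : PMF (Fin N → ℤˣ)) (σ : ι → Fin N) (k l : ι) (n : ℕ)
    (d : ι → SoftBit) :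
    ∃ (g : SoftBit → ℝ) (C : ℝ), Measurable g ∧ (∀ e, |g e| ≤ C) ∧
      (∀ e, |extrinsicBias p σ k n (Function.update d l e)| ≤ C) ∧
      Measurable (fun e =>
        extrinsicBias p σ k n (Function.update d l e)) ∧
      ∀ e e₀ : SoftBit,
        extrinsicBias p σ k n (Function.update d l e₀) +
          g e₀ * (e - e₀) ≤
        extrinsicBias p σ k n (Function.update d l e) := by
  obtain ⟨α, β, h⟩ := extrinsicWeight_update_affine p σ k l d
  exact exists_subgradient_biasMoment _ n h fun e x => jointWeight_nonneg _ _ _ _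

theorem integrable_integral_extrinsicBias_update (p : PMF (Fin N → ℤˣ)) (W : ℝ → BMSChannel)
    (σ : ι → Fin N) (k l : ι) (τ : ι → ℝ) (s : ℝ) (n : ℕ) :
    Integrable (fun d => ∫ e, extrinsicBias p σ k n (Function.update d l e) ∂(W s).softLaw)
      (softLawPi W τ) :=
  (integrable_of_abs_le (f := fun z : (ι → SoftBit) × SoftBit =>
    extrinsicBias p σ k n (Function.update z.1 l z.2)) (μ := (softLawPi W τ).prod (W s).softLaw)
    ((measurable_extrinsicBias p σ k n).comp (measurable_update_softBit l))
      fun _ => abs_extrinsicBias_le p σ k n _).integral_prod_left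

/-- Degrading one observation decreases the extrinsic moments. -/
theorem extrinsicMoment_update_le (p : PMF (Fin N → ℤˣ)) {W : ℝ → BMSChannel} (σ : ι → Fin N)
    (k l : ι) (τ : ι → ℝ) {s t : ℝ} (h : (W t).IsDegradedOf (W s)) (n : ℕ) :
    extrinsicMoment p W σ k (Function.update τ l t) n ≤
      extrinsicMoment p W σ k (Function.update τ l s) n := by
  rw [extrinsicMoment_update, extrinsicMoment_update]
  refine integral_mono (integrable_integral_extrinsicBias_update p W σ k l τ t n)
    (integrable_integral_extrinsicBias_update p W σ k l τ s n) fun d => ?_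
  obtain ⟨g, C, hgm, hgC, hfC, hfm, ht⟩ := exists_subgradient_extrinsic p σ k l n d
  exact h.integral_softLaw_le hfm hgm hfC hgC ht

/-- Erasing one observation decreases the extrinsic moments. -/
theorem integral_erase_le_extrinsicMoment (p : PMF (Fin N → ℤˣ)) (W : ℝ → BMSChannel)
    (σ : ι → Fin N) (k l : ι) (τ : ι → ℝ) (n : ℕ) :
    ∫ d, extrinsicBias p σ k n (Function.update d l SoftBit.zero) ∂softLawPi W τ ≤
      extrinsicMoment p W σ k τ n := by
  conv_rhs => rw [← Function.update_eq_self l τ]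
  rw [extrinsicMoment_update]
  refine integral_mono (integrable_of_abs_le
    ((measurable_extrinsicBias p σ k n).comp
      ((measurable_update_softBit l).comp (measurable_id.prodMk measurable_const)))
      fun d => abs_extrinsicBias_le p σ k n _)
    (integrable_integral_extrinsicBias_update p W σ k l τ _ n) fun d => ?_
  obtain ⟨g, C, hgm, hgC, hfC, hfm, ht⟩ := exists_subgradient_extrinsic p σ k l n d
  have hi : Integrable (fun e : SoftBit => (e : ℝ)) (W (τ l)).softLaw :=
    integrable_of_abs_le measurable_subtype_coe SoftBit.abs_le_one
  -- Jensen's inequality at the erased soft bit: the linear term integrates to zero because the soft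
  -- law has mean zero.
  have := integral_mono ((integrable_const (μ := (W (τ l)).softLaw)
    (extrinsicBias p σ k n (Function.update d l SoftBit.zero))).fun_add
    (hi.const_mul (g SoftBit.zero))) (integrable_of_abs_le hfm hfC) fun e => by
      simpa [SoftBit.zero] using ht e SoftBit.zero
  rw [integral_add (integrable_const _) (hi.const_mul _), integral_const_mul,
    BMSChannel.integral_softLaw_coe] at this
  simpa using this

end Experiment

/-! ### The entropies as antitone and weighted expansions -/

/-- The coefficients of the expansion of the binary entropy in bits. -/
noncomputable def bitCoeff (n : ℕ) : ℝ := entropyCoeff n / Real.log 2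

theorem log_two_pos : 0 < Real.log 2 := Real.log_pos one_lt_two

theorem BMSChannel.IsDegradedOf.softMoment_le {V W : BMSChannel} (h : V.IsDegradedOf W) (n : ℕ) :
    V.softMoment n ≤ W.softMoment n := by
  refine h.integral_softLaw_le (f := fun d => (d : ℝ) ^ (2 * n + 2))
    (g := fun d => (2 * n + 2) * (d : ℝ) ^ (2 * n + 1)) (C := 2 * n + 2)
    (SoftBit.measurable_pow _) ((SoftBit.measurable_pow _).const_mul _) (fun d => ?_)
    (fun d => ?_) fun d d₀ => ?_
  · rw [abs_of_nonneg (d.pow_mem n).1]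
    exact (d.pow_mem n).2.trans (by linarith [(n.cast_nonneg : (0 : ℝ) ≤ n)])
  · rw [abs_mul, abs_pow, abs_of_nonneg (by positivity : (0 : ℝ) ≤ 2 * n + 2)]
    exact mul_le_of_le_one_right (by positivity) (pow_le_one₀ (abs_nonneg _) d.abs_le_one)
  · refine le_trans (le_of_eq ?_) (even_pow_tangent n (d : ℝ) d₀)
    ring

/-- The entropy loss formula with a trivial prior observation: the two weights `1/2` have zero bias,
so every coefficient appears in full, and the starting entropy is `log 2`. -/
theorem channelEntropy_eq_tsum (W : ℝ → BMSChannel) (t : ℝ) :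
    channelEntropy W t = 1 - ∑' n, bitCoeff n * (W t).softMoment n := by
  have h := hasSum_integral_entropy_loss (Measure.dirac ()) (W t) (id : ℤˣ → ℤˣ)
    (q := fun _ _ => 2⁻¹) (C := 2⁻¹) measurable_const (fun _ _ => by norm_num) fun _ _ => le_rfl
  have hu : ∑ _x : ℤˣ, (2⁻¹ : ℝ) = 1 := by simp
  have hb : ∀ n, biasMoment (id : ℤˣ → ℤˣ) n (fun _ => 2⁻¹) = 0 := fun n => by
    have : signedSum (id : ℤˣ → ℤˣ) (fun _ => 2⁻¹) = 0 := by
      rw [signedSum, show (Finset.univ : Finset ℤˣ) = {1, -1} from rfl,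
        Finset.sum_pair (by decide)]
      simp
    rw [biasMoment, this]; simp
  have he : weightEntropy (fun _ : ℤˣ => (2⁻¹ : ℝ)) = Real.log 2 := by
    rw [weightEntropy, hu]
    simp [Real.negMulLog]
  have hi : Integrable (fun z : Unit × SoftBit =>
      weightEntropy fun a => 2⁻¹ * likelihood (id a) z.2) ((Measure.dirac ()).prod (W t).softLaw) := by
    obtain ⟨B, hB⟩ := exists_bound_weightEntropy ℤˣ (2⁻¹ * 2)
    refine integrable_of_abs_le (C := B) (continuous_weightEntropy.measurable.comp
      (measurable_pi_lambda _ fun a => ((measurable_likelihood _).comp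
        measurable_snd).const_mul _)) fun z => hB _ (fun a => ?_) fun a => ?_
    · exact mul_nonneg (by norm_num) (likelihood_nonneg _ _)
    · exact mul_le_mul_of_nonneg_left (likelihood_le_two _ _) (by norm_num)
  simp only [hu, hb, he, integral_dirac, sub_zero, mul_one] at h
  rw [integral_prod _ hi, integral_dirac] at h
  have h' := h.div_const (Real.log 2)
  have hsum : ∑' n, bitCoeff n * (W t).softMoment n = (Real.log 2 -
      ∫ d, weightEntropy (fun a => 2⁻¹ * likelihood (id a) d) ∂(W t).softLaw) / Real.log 2 := by
    rw [← h'.tsum_eq]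
    exact tsum_congr fun n => by rw [bitCoeff]; ring
  rw [hsum, channelEntropy_eq_integral, sub_div, div_self log_two_pos.ne']
  simp

theorem IsACDegradedFamily.isAntitoneExpansion {W : ℝ → BMSChannel} (hW : IsACDegradedFamily W) :
    IsAntitoneExpansion bitCoeff (fun n t => (W t).softMoment n) (channelEntropy W) where
  coeff_pos n := div_pos (entropyCoeff_pos n) log_two_pos
  summable_coeff := summable_entropyCoeff.div_const _
  mem_unit n t := (W t).softMoment_mem n
  antitoneOn n _ hs _ ht hst := (hW.degraded _ _ hs.1 hst ht.2).softMoment_le n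
  eq_one_sub_tsum t _ := channelEntropy_eq_tsum W t
  absolutelyContinuous := hW.absolutelyContinuous

theorem IsACDegradedFamily.channelEntropy_sub_le_one {W : ℝ → BMSChannel}
    (hW : IsACDegradedFamily W) : channelEntropy W 1 - channelEntropy W 0 ≤ 1 := by
  have h := hW.isAntitoneExpansion
  rw [channelEntropy_eq_tsum, channelEntropy_eq_tsum]
  have h1 : 0 ≤ ∑' n, bitCoeff n * (W 1).softMoment n :=
    tsum_nonneg fun n => mul_nonneg (h.coeff_pos n).le ((W 1).softMoment_mem n).1
  have h0 : ∑' n, bitCoeff n * (W 0).softMoment n ≤ ∑' n, bitCoeff n :=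
    (h.summable_term 0).tsum_le_tsum
      (fun n => mul_le_of_le_one_right (h.coeff_pos n).le ((W 0).softMoment_mem n).2)
      h.summable_coeff
  have hc : ∑' n, bitCoeff n = 1 := by
    simp only [bitCoeff]
    rw [tsum_div_const, tsum_entropyCoeff, div_self log_two_pos.ne']
  linarith

section Weights

variable {N : ℕ} {ι : Type*} [Fintype ι] [DecidableEq ι]

/-- The weights of the expansion of the conditional entropy in the parameter of observation `k`. -/
noncomputable def gexitWeight (p : PMF (Fin N → ℤˣ)) (W : ℝ → BMSChannel) (σ : ι → Fin N)
    (k : ι) (τ : ι → ℝ) (n : ℕ) : ℝ :=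
  1 - extrinsicMoment p W σ k τ n

/-- The reference entropy, with observation `k` erased, does not involve `s`, and neither do the
weights; differences in `s` thus have the form required by `IsWeightedExpansion`. -/
theorem hasSum_condEntropy_update (p : PMF (Fin N → ℤˣ)) (W : ℝ → BMSChannel) (σ : ι → Fin N)
    (k : ι) (τ : ι → ℝ) (s : ℝ) :
    HasSum (fun n => bitCoeff n * (W s).softMoment n * gexitWeight p W σ k τ n)
      ((∫ d, weightEntropy (extrinsicWeight p σ k d) ∂softLawPi W τ) / Real.log 2 -
        condEntropy p (observationLaw W σ (Function.update τ k s))) := by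
  have h := (hasSum_integral_entropy_loss (softLawPi W τ) (W s)
    (fun x : Fin N → ℤˣ => x (σ k)) (measurable_extrinsicWeight p σ k)
    (C := 2 ^ Fintype.card ι) (fun d x => jointWeight_nonneg _ _ _ _)
    fun d x => jointWeight_le _ _ _ _).div_const (Real.log 2)
  have hmp := measurePreserving_update W τ k s
  rw [condEntropy_observationLaw, ← hmp.map_eq, integral_map hmp.measurable.aemeasurable
    (measurable_weightEntropy_jointWeight p σ).aestronglyMeasurable, ← sub_div]
  have hq : ∀ z : (ι → SoftBit) × SoftBit, jointWeight p σ (Function.update z.1 k z.2) =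
      fun x => extrinsicWeight p σ k z.1 x * likelihood (x (σ k)) z.2 := fun z =>
    funext fun x => jointWeight_update p σ z.1 k z.2 x
  simp_rw [hq]
  refine h.congr_fun fun n => ?_
  have hint : ∫ d, (∑ x, extrinsicWeight p σ k d x -
      biasMoment (fun x => x (σ k)) n (extrinsicWeight p σ k d)) ∂softLawPi W τ =
      gexitWeight p W σ k τ n := by
    change ∫ d, (∑ x, extrinsicWeight p σ k d x - extrinsicBias p σ k n d) ∂softLawPi W τ = _
    rw [integral_sub (integrable_finsetSum _ fun x _ => integrable_extrinsicWeight p W σ k τ x)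
      (integrable_extrinsicBias p σ k n _), integral_sum_extrinsicWeight]
    rfl
  rw [hint, bitCoeff]
  ring

theorem extrinsicMoment_antitoneOn (p : PMF (Fin N → ℤˣ)) {W : ℝ → BMSChannel}
    (hW : IsACDegradedFamily W) (σ : ι → Fin N) (k : ι) (n : ℕ) :
    AntitoneOn (fun τ => extrinsicMoment p W σ k τ n) (Icc 0 1) := by
  intro τ hτ τ' hτ' hle
  have key : ∀ S : Finset ι, extrinsicMoment p W σ k (S.piecewise τ' τ) n ≤
      extrinsicMoment p W σ k τ n := by
    intro S
    induction S using Finset.induction_on with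
    | empty => simp
    | insert l S hl ih =>
      refine le_trans ?_ ih
      rw [Finset.piecewise_insert]
      have h := extrinsicMoment_update_le p σ k l (S.piecewise τ' τ)
        (hW.degraded (τ l) (τ' l) (hτ.1 l) (hle l) (hτ'.2 l)) n
      have hself : Function.update (S.piecewise τ' τ) l (τ l) = S.piecewise τ' τ := by
        rw [Function.update_eq_self_iff]; simp [hl]
      rwa [hself] at h
  simpa using key Finset.univ

theorem IsACDegradedFamily.isWeightedExpansion (p : PMF (Fin N → ℤˣ)) {W : ℝ → BMSChannel}
    (hW : IsACDegradedFamily W) (σ : ι → Fin N) :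
    IsWeightedExpansion bitCoeff (fun n t => (W t).softMoment n)
      (fun τ : ι → ℝ => condEntropy p (observationLaw W σ τ)) (gexitWeight p W σ) where
  update_sub_update k τ s s' := by
    have h := (hasSum_condEntropy_update p W σ k τ s).sub (hasSum_condEntropy_update p W σ k τ s')
    rw [sub_sub_sub_cancel_left] at h
    rw [← h.tsum_eq]
    exact tsum_congr fun n => by ring
  weight_mem k τ n := by
    have h := extrinsicMoment_mem p W σ k τ n
    exact ⟨sub_nonneg.mpr h.2, sub_le_self _ h.1⟩
  weight_mono k n τ hτ τ' hτ' hle :=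
    sub_le_sub_left (extrinsicMoment_antitoneOn p hW σ k n hτ hτ' hle) 1

end Weights

/-! ### Entropies at the two ends of the channel family -/

section Endpoints

variable {N : ℕ} {ι : Type*} [Fintype ι]

theorem ae_softLawPi (W : ℝ → BMSChannel) (τ : ι → ℝ) {P : SoftBit → Prop}
    (h : ∀ k, ∀ᵐ d ∂(W (τ k)).softLaw, P d) : ∀ᵐ d ∂softLawPi W τ, ∀ k, P (d k) :=
  ae_all_iff.mpr fun k => (Measure.quasiMeasurePreserving_eval _ k).ae (h k)

theorem condEntropy_of_uninformative (p : PMF (Fin N → ℤˣ)) {W : ℝ → BMSChannel} {t : ℝ}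
    (h : (W t).IsUninformative) (σ : ι → Fin N) :
    condEntropy p (observationLaw W σ fun _ => t) =
      weightEntropy (fun x => (p x).toReal) / Real.log 2 := by
  rw [condEntropy_observationLaw]
  have hae : ∀ᵐ d ∂softLawPi W (fun _ : ι => t), weightEntropy (jointWeight p σ d) =
      weightEntropy fun x => (p x).toReal := by
    filter_upwards [ae_softLawPi W (fun _ => t) fun _ => h.softLaw_ae_eq_zero] with d hd
    congr 1
    ext x
    simp [jointWeight, vectorLikelihood, likelihood, hd]
  rw [integral_congr_ae hae]
  simp

theorem weightEntropy_eq_zero {A : Type*} [Fintype A] {v : A → ℝ}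
    (h : ∀ a b, a ≠ b → v a = 0 ∨ v b = 0) : weightEntropy v = 0 := by
  classical
  by_cases hv : ∃ a, v a ≠ 0
  · obtain ⟨a, ha⟩ := hv
    have hz : ∀ b, b ≠ a → v b = 0 := fun b hb => (h b a hb).resolve_right ha
    rw [weightEntropy, Finset.sum_eq_single a (fun b _ hb => by simp [hz b hb]) (by simp),
      Finset.sum_eq_single a (fun b _ hb => hz b hb) (by simp), sub_self]
  · push Not at hv
    simp [weightEntropy, hv]

/-- Soft bits equal to `±1` give likelihood zero to every input with the wrong sign at an observed
coordinate. As `σ` covers all coordinates, at most one input vector keeps positive weight. -/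
theorem condEntropy_of_perfect (p : PMF (Fin N → ℤˣ)) {W : ℝ → BMSChannel} {t : ℝ}
    (h : (W t).IsPerfect) {σ : ι → Fin N} (hσ : Function.Surjective σ) :
    condEntropy p (observationLaw W σ fun _ => t) = 0 := by
  rw [condEntropy_observationLaw]
  have hae : ∀ᵐ d ∂softLawPi W (fun _ : ι => t), weightEntropy (jointWeight p σ d) = 0 := by
    filter_upwards [ae_softLawPi W (fun _ => t) fun _ => h.softLaw_ae_sq_eq_one] with d hd
    refine weightEntropy_eq_zero fun x y hxy => ?_
    obtain ⟨i, hi⟩ := Function.ne_iff.mp hxy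
    obtain ⟨k, rfl⟩ := hσ i
    have key : ∀ z : Fin N → ℤˣ, likelihood (z (σ k)) (d k) = 0 → jointWeight p σ d z = 0 :=
      fun z hz => by
        rw [jointWeight, vectorLikelihood, Finset.prod_eq_zero (Finset.mem_univ k) hz, mul_zero]
    rcases Int.units_eq_one_or (x (σ k)) with hx | hx <;>
    rcases Int.units_eq_one_or (y (σ k)) with hy | hy <;> rcases hd k with h1 | h1
    all_goals first
      | exact absurd (hx.trans hy.symm) hi
      | (refine Or.inl (key x ?_); simp [likelihood, hx, h1]; done)
      | (refine Or.inr (key y ?_); simp [likelihood, hy, h1])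
  rw [integral_congr_ae hae]
  simp

end Endpoints

/-! ### Invariance under relabelling of observations and symmetries of the input -/

section Relabel

variable {N : ℕ} {ι κ : Type*} [Fintype ι] [Fintype κ]

theorem weightEntropy_comp_equiv {A : Type*} [Fintype A] (f : A ≃ A) (v : A → ℝ) :
    weightEntropy (fun a => v (f a)) = weightEntropy v := by
  rw [weightEntropy, weightEntropy, Equiv.sum_comp f v,
    Equiv.sum_comp f fun a => Real.negMulLog (v a)]

/-- Relabelling the observations and permuting the coordinates of the input. -/
theorem condEntropy_relabel (p : PMF (Fin N → ℤˣ)) (W : ℝ → BMSChannel) {σ : ι → Fin N}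
    {σ' : κ → Fin N} (e : ι ≃ κ) (π : Equiv.Perm (Fin N)) (hp : ∀ x, p (x ∘ π) = p x)
    (h : ∀ k, σ' (e k) = π (σ k)) (τ : κ → ℝ) :
    condEntropy p (observationLaw W σ (τ ∘ e)) = condEntropy p (observationLaw W σ' τ) := by
  rw [condEntropy_observationLaw, condEntropy_observationLaw]
  congr 1
  have hmp := measurePreserving_piCongrLeft (fun k => (W (τ k)).softLaw) e
  have hmp' : MeasurePreserving (MeasurableEquiv.piCongrLeft (fun _ : κ => SoftBit) e)
      (softLawPi W (τ ∘ e)) (softLawPi W τ) := hmp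
  rw [← hmp'.map_eq, integral_map hmp'.measurable.aemeasurable
    (measurable_weightEntropy_jointWeight p σ').aestronglyMeasurable]
  refine integral_congr_ae (Eventually.of_forall fun d => ?_)
  have hd : ∀ k, MeasurableEquiv.piCongrLeft (fun _ : κ => SoftBit) e d (e k) = d k := fun k => by
    rw [MeasurableEquiv.coe_piCongrLeft]
    exact Equiv.piCongrLeft_apply_apply (fun _ : κ => SoftBit) e d k
  have hw : jointWeight p σ' (MeasurableEquiv.piCongrLeft (fun _ : κ => SoftBit) e d) =
      fun x => jointWeight p σ d ((π.symm.arrowCongr (Equiv.refl ℤˣ)) x) := by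
    funext x
    have hx : (π.symm.arrowCongr (Equiv.refl ℤˣ)) x = x ∘ π := by
      ext i; simp [Equiv.arrowCongr]
    rw [hx, jointWeight, jointWeight, hp, vectorLikelihood, vectorLikelihood,
      ← Equiv.prod_comp e]
    simp only [hd, h, Function.comp_apply]
  show _ = weightEntropy _
  rw [hw, weightEntropy_comp_equiv]

theorem apply_comp_of_mem_symmetryGroup {p : PMF (Fin N → ℤˣ)} {π : Equiv.Perm (Fin N)}
    (h : π ∈ symmetryGroup p) (x : Fin N → ℤˣ) : p (x ∘ π) = p x := by
  have h' : p.map (fun x => x ∘ π) = p := h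
  conv_lhs => rw [← h']
  rw [PMF.map_apply, tsum_eq_single x]
  · simp
  · intro y hy
    rw [if_neg]
    intro heq
    exact hy (π.surjective.injective_comp_right heq).symm

end Relabel

/-! ### Discarding the second look -/

section Drop

variable {N : ℕ}

theorem measurePreserving_comp_some (W : ℝ → BMSChannel) (t : ℝ) :
    MeasurePreserving (fun (d : Option (Fin N) → SoftBit) i => d (some i))
      (softLawPi W fun _ => t) (softLawPi W fun _ => t) := by
  have hm : Measurable fun (d : Option (Fin N) → SoftBit) i => d (some i) :=
    measurable_pi_lambda _ fun i => measurable_pi_apply _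
  refine ⟨hm, (Measure.pi_eq fun S hS => ?_).symm⟩
  rw [Measure.map_apply hm (MeasurableSet.univ_pi hS)]
  have : (fun (d : Option (Fin N) → SoftBit) i => d (some i)) ⁻¹' univ.pi S =
      univ.pi fun o : Option (Fin N) => o.elim univ S := by
    ext d
    simp only [mem_preimage, Set.mem_pi, mem_univ, true_imp_iff]
    constructor
    · rintro h (_ | i)
      · exact mem_univ _
      · exact h i
    · exact fun h i => h (some i)
  rw [this, softLawPi, Measure.pi_pi, Fintype.prod_option]
  simp

theorem extrinsicBias_erase_extra (p : PMF (Fin N → ℤˣ)) (i j : Fin N) (n : ℕ)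
    (d : Option (Fin N) → SoftBit) :
    extrinsicBias p (extraLook j) (some i) n (Function.update d none SoftBit.zero) =
      extrinsicBias p id i n fun l => d (some l) := by
  have h : extrinsicWeight p (extraLook j) (some i) (Function.update d none SoftBit.zero) =
      extrinsicWeight p id i fun l => d (some l) := by
    funext x
    rw [extrinsicWeight, extrinsicWeight, jointWeight, jointWeight, vectorLikelihood,
      vectorLikelihood, Fintype.prod_option]
    have h0 : Function.update (Function.update d none SoftBit.zero) (some i) SoftBit.zero none =
        SoftBit.zero := by simp
    rw [h0, likelihood_zero, one_mul]
    congr 1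
    refine Finset.prod_congr rfl fun l _ => ?_
    by_cases hl : l = i
    · subst hl; simp [extraLook]
    · simp [extraLook, hl]
  rw [extrinsicBias, extrinsicBias, h]
  rfl

/-- A second look at some coordinate decreases the weights. -/
theorem gexitWeight_extra_le (p : PMF (Fin N → ℤˣ)) (W : ℝ → BMSChannel) (i j : Fin N) (t : ℝ)
    (n : ℕ) : gexitWeight p W (extraLook j) (some i) (fun _ => t) n ≤
      gexitWeight p W id i (fun _ => t) n := by
  refine sub_le_sub_left ?_ 1
  -- Erasing the observation `none` can only lower the extrinsic moment, and what remains is the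
  -- experiment with single looks.
  have h := integral_erase_le_extrinsicMoment p W (extraLook j) (some i) none (fun _ => t) n
  refine le_trans (le_of_eq ?_) h
  have hmp := measurePreserving_comp_some (N := N) W t
  rw [extrinsicMoment, ← hmp.map_eq, integral_map hmp.measurable.aemeasurable
    (measurable_extrinsicBias p id i n).aestronglyMeasurable]
  exact integral_congr_ae (Eventually.of_forall fun d =>
    (extrinsicBias_erase_extra p i j n d).symm)

theorem extraLook_surjective (j : Fin N) : Function.Surjective (extraLook j) := fun i =>
  ⟨some i, rfl⟩

end Drop

/-! ### GEXIT functions and their total area -/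

section Gexit

variable {N : ℕ} {ι : Type*} [Fintype ι] [DecidableEq ι]

/-- The termwise derivative of the conditional entropy in the parameter of observation `k`. -/
noncomputable def gexitSeries (p : PMF (Fin N → ℤˣ)) (W : ℝ → BMSChannel) (σ : ι → Fin N)
    (k : ι) (t : ℝ) : ℝ :=
  partialDeriv bitCoeff (fun n t => (W t).softMoment n) (gexitWeight p W σ) k t

theorem hasDerivAt_perturbedEntropy (p : PMF (Fin N → ℤˣ)) {W : ℝ → BMSChannel}
    (hW : IsACDegradedFamily W) (σ : ι → Fin N) (k : ι) {t : ℝ}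
    (ht : IsTermwiseDifferentiable bitCoeff (fun n t => (W t).softMoment n)
      (channelEntropy W) t) :
    HasDerivAt (perturbedEntropy p W σ k t) (gexitSeries p W σ k t) t :=
  (hW.isWeightedExpansion p σ).hasDerivAt_update hW.isAntitoneExpansion ht k

theorem hasDerivWithinAt_perturbedEntropy (p : PMF (Fin N → ℤˣ)) {W : ℝ → BMSChannel}
    (hW : IsACDegradedFamily W) (σ : ι → Fin N) (k : ι) :
    ∀ᵐ t : ℝ, t ∈ Icc (0 : ℝ) 1 → HasDerivWithinAt (perturbedEntropy p W σ k t)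
      (gexitSeries p W σ k t) (Icc 0 1) t := by
  filter_upwards [hW.isAntitoneExpansion.ae_isTermwiseDifferentiable] with t ht hmem
  exact (hasDerivAt_perturbedEntropy p hW σ k (ht hmem)).hasDerivWithinAt

theorem ae_differentiableWithinAt_perturbedEntropy (p : PMF (Fin N → ℤˣ)) {W : ℝ → BMSChannel}
    (hW : IsACDegradedFamily W) (σ : ι → Fin N) (k : ι) :
    ∀ᵐ t ∂volume.restrict (Icc (0 : ℝ) 1),
      DifferentiableWithinAt ℝ (perturbedEntropy p W σ k t) (Icc 0 1) t := by
  rw [ae_restrict_iff' measurableSet_Icc]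
  filter_upwards [hasDerivWithinAt_perturbedEntropy p hW σ k] with t ht hmem
  exact (ht hmem).differentiableWithinAt

theorem gexitSeries_ae_eq (p : PMF (Fin N → ℤˣ)) {W : ℝ → BMSChannel}
    (hW : IsACDegradedFamily W) (σ : ι → Fin N) (k : ι) :
    ∀ᵐ t : ℝ, t ∈ uIoc (0 : ℝ) 1 → gexitSeries p W σ k t =
      derivWithin (perturbedEntropy p W σ k t) (Icc 0 1) t := by
  filter_upwards [hasDerivWithinAt_perturbedEntropy p hW σ k] with t ht hmem
  rw [uIoc_of_le zero_le_one] at hmem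
  have hmem' := Ioc_subset_Icc_self hmem
  exact ((ht hmem').derivWithin (uniqueDiffOn_Icc zero_lt_one t hmem')).symm

theorem intervalIntegrable_gexitSeries (p : PMF (Fin N → ℤˣ)) {W : ℝ → BMSChannel}
    (hW : IsACDegradedFamily W) (σ : ι → Fin N) (k : ι) :
    IntervalIntegrable (gexitSeries p W σ k) volume 0 1 :=
  (hW.isWeightedExpansion p σ).intervalIntegrable_partialDeriv hW.isAntitoneExpansion k

theorem intervalIntegrable_derivWithin_perturbedEntropy (p : PMF (Fin N → ℤˣ))
    {W : ℝ → BMSChannel} (hW : IsACDegradedFamily W) (σ : ι → Fin N) (k : ι) :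
    IntervalIntegrable (fun t => derivWithin (perturbedEntropy p W σ k t) (Icc 0 1) t)
      volume 0 1 := by
  refine (intervalIntegrable_gexitSeries p hW σ k).congr_ae ?_
  rw [EventuallyEq, ae_restrict_iff' measurableSet_uIoc]
  exact gexitSeries_ae_eq p hW σ k

/-- The area theorem between the two endpoint entropies. The total does not depend on the pattern
`σ`, which makes the experiments with and without a second look comparable. -/
theorem sum_integral_gexitSeries (p : PMF (Fin N → ℤˣ)) {W : ℝ → BMSChannel}
    (hW : IsACDegradedFamily W) {σ : ι → Fin N} (hσ : Function.Surjective σ) :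
    ∑ k, ∫ t in (0 : ℝ)..1, gexitSeries p W σ k t =
      weightEntropy (fun x => (p x).toReal) / Real.log 2 := by
  have h := (hW.isWeightedExpansion p σ).sum_integral_partialDeriv hW.isAntitoneExpansion
  rw [condEntropy_of_uninformative p hW.uninformative, condEntropy_of_perfect p hW.perfect hσ,
    sub_zero] at h
  exact h

theorem integral_gexitSeries_le_one (p : PMF (Fin N → ℤˣ)) {W : ℝ → BMSChannel}
    (hW : IsACDegradedFamily W) (σ : ι → Fin N) (k : ι) :
    ∫ t in (0 : ℝ)..1, gexitSeries p W σ k t ≤ 1 :=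
  ((hW.isWeightedExpansion p σ).integral_partialDeriv_le hW.isAntitoneExpansion k).trans
    hW.channelEntropy_sub_le_one

end Gexit

/-! ### Influence of a second look, and the effect of symmetry -/

section TwoLooks

variable {N : ℕ}

/-- Given the input, the two looks at `j` are exchangeable: transpose `none` and `some j`, leaving
the input alone. -/
theorem perturbedEntropy_extra_swap (p : PMF (Fin N → ℤˣ)) (W : ℝ → BMSChannel) (j : Fin N)
    (t s : ℝ) : perturbedEntropy p W (extraLook j) none t s =
      perturbedEntropy p W (extraLook j) (some j) t s := by
  have h := condEntropy_relabel p W (σ := extraLook j) (σ' := extraLook j)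
    (Equiv.swap none (some j)) (Equiv.refl (Fin N)) (fun x => rfl) (fun k => by
      rcases k with _ | i
      · simp [extraLook]
      · by_cases hi : i = j
        · subst hi; simp [extraLook]
        · rw [Equiv.swap_apply_of_ne_of_ne (by simp) (by simpa using hi)]; rfl)
    (Function.update (fun _ => t) (some j) s)
  rw [perturbedEntropy, perturbedEntropy, ← h]
  congr 2
  funext k
  rcases k with _ | i
  · simp
  · by_cases hi : i = j
    · subst hi; simp
    · rw [Function.comp_apply, Equiv.swap_apply_of_ne_of_ne (by simp) (by simpa using hi)]
      simp [hi]

theorem integral_gexitSeries_extra_le (p : PMF (Fin N → ℤˣ)) {W : ℝ → BMSChannel}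
    (hW : IsACDegradedFamily W) (i j : Fin N) :
    ∫ t in (0 : ℝ)..1, gexitSeries p W (extraLook j) (some i) t ≤
      ∫ t in (0 : ℝ)..1, gexitSeries p W id i t := by
  refine intervalIntegral.integral_mono_ae_restrict zero_le_one
    (intervalIntegrable_gexitSeries p hW _ _) (intervalIntegrable_gexitSeries p hW _ _) ?_
  rw [EventuallyLE, ae_restrict_iff' measurableSet_Icc]
  filter_upwards [hW.isAntitoneExpansion.ae_isTermwiseDifferentiable] with t ht hmem
  exact (hW.isWeightedExpansion p (extraLook j)).partialDeriv_le_partialDeriv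
    (hW.isWeightedExpansion p id) hW.isAntitoneExpansion (ht hmem)
    fun n => gexitWeight_extra_le p W i j t n

theorem integral_gexitSeries_none (p : PMF (Fin N → ℤˣ)) {W : ℝ → BMSChannel}
    (hW : IsACDegradedFamily W) (j : Fin N) :
    ∫ t in (0 : ℝ)..1, gexitSeries p W (extraLook j) none t =
      ∫ t in (0 : ℝ)..1, gexitSeries p W (extraLook j) (some j) t := by
  refine intervalIntegral.integral_congr_ae ?_
  filter_upwards [gexitSeries_ae_eq p hW (extraLook j) none,
    gexitSeries_ae_eq p hW (extraLook j) (some j)] with t h1 h2 ht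
  rw [h1 ht, h2 ht, funext (perturbedEntropy_extra_swap p W j t)]

theorem integral_gexit_sub (p : PMF (Fin N → ℤˣ)) {W : ℝ → BMSChannel}
    (hW : IsACDegradedFamily W) (i j : Fin N) :
    ∫ t in (0 : ℝ)..1, (gexit p W i t - gexitExtra p W i j t) =
      (∫ t in (0 : ℝ)..1, gexitSeries p W id i t) -
        ∫ t in (0 : ℝ)..1, gexitSeries p W (extraLook j) (some i) t := by
  rw [← intervalIntegral.integral_sub (intervalIntegrable_gexitSeries p hW _ _)
    (intervalIntegrable_gexitSeries p hW _ _)]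
  refine intervalIntegral.integral_congr_ae ?_
  filter_upwards [gexitSeries_ae_eq p hW id i,
    gexitSeries_ae_eq p hW (extraLook j) (some i)] with t h1 h2 ht
  rw [h1 ht, h2 ht]
  rfl

/-- The total influence of a second look at one coordinate is at most one bit. -/
theorem sum_integral_gexit_sub_le_one (p : PMF (Fin N → ℤˣ)) {W : ℝ → BMSChannel}
    (hW : IsACDegradedFamily W) (j : Fin N) :
    ∑ i : Fin N with i ≠ j, ∫ t in (0 : ℝ)..1, (gexit p W i t - gexitExtra p W i j t) ≤ 1 := by
  simp_rw [integral_gexit_sub p hW]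
  have h1 := sum_integral_gexitSeries p hW (σ := id) Function.surjective_id
  have h2 := sum_integral_gexitSeries p hW (extraLook_surjective j)
  rw [Fintype.sum_option, integral_gexitSeries_none p hW] at h2
  -- Taken at `i = j`. If `a` and `b` are the integrals for `j` without and with the second look,
  -- the area identities turn the sum into `2b - a`, and `b ≤ a ≤ 1`.
  have h3 := integral_gexitSeries_extra_le p hW j j
  have h4 := integral_gexitSeries_le_one p hW id j
  rw [Finset.filter_ne', Finset.sum_erase_eq_sub (Finset.mem_univ j), Finset.sum_sub_distrib]
  linarith

theorem sum_sum_integral_gexit_sub_le (p : PMF (Fin N → ℤˣ)) {W : ℝ → BMSChannel}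
    (hW : IsACDegradedFamily W) :
    ∑ i : Fin N, ∑ j : Fin N with i ≠ j,
      ∫ t in (0 : ℝ)..1, (gexit p W i t - gexitExtra p W i j t) ≤ (N : ℝ) := by
  simp_rw [Finset.sum_filter]
  rw [Finset.sum_comm]
  have h := Finset.sum_le_sum (s := Finset.univ) fun j (_ : j ∈ Finset.univ) =>
    sum_integral_gexit_sub_le_one p hW j
  simp_rw [Finset.sum_filter] at h
  simpa using h

theorem entropyAt_eq_of_mem_symmetryGroup {p : PMF (Fin N → ℤˣ)} (W : ℝ → BMSChannel)
    {π : Equiv.Perm (Fin N)} (hπ : π ∈ symmetryGroup p) (i : Fin N) (t s : ℝ) :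
    entropyAt p W i t s = entropyAt p W (π i) t s := by
  have h := condEntropy_relabel p W (σ := id) (σ' := id) π π
    (apply_comp_of_mem_symmetryGroup hπ) (fun _ => rfl) (Function.update (fun _ => t) (π i) s)
  rw [entropyAt, entropyAt, perturbedEntropy, perturbedEntropy, ← h,
    Function.update_comp_eq_of_injective _ π.injective]
  rfl

theorem entropyAtExtra_eq_of_mem_symmetryGroup {p : PMF (Fin N → ℤˣ)} (W : ℝ → BMSChannel)
    {π : Equiv.Perm (Fin N)} (hπ : π ∈ symmetryGroup p) (i j : Fin N) (t s : ℝ) :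
    entropyAtExtra p W i j t s = entropyAtExtra p W (π i) (π j) t s := by
  have h := condEntropy_relabel p W (σ := extraLook j) (σ' := extraLook (π j))
    (Equiv.optionCongr π) π (apply_comp_of_mem_symmetryGroup hπ)
    (fun k => by cases k <;> simp [extraLook])
    (Function.update (fun _ => t) (Equiv.optionCongr π (some i)) s)
  rw [entropyAtExtra, entropyAtExtra, perturbedEntropy, perturbedEntropy,
    show (some (π i) : Option (Fin N)) = Equiv.optionCongr π (some i) by simp, ← h,
    Function.update_comp_eq_of_injective _ (Equiv.optionCongr π).injective]
  rfl

/-- The perturbed entropies agree as functions of `s`, so their `derivWithin` agree at every `t`,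
differentiable or not. -/
theorem gexit_eq_of_mem_symmetryGroup {p : PMF (Fin N → ℤˣ)} (W : ℝ → BMSChannel)
    {π : Equiv.Perm (Fin N)} (hπ : π ∈ symmetryGroup p) (i : Fin N) (t : ℝ) :
    gexit p W i t = gexit p W (π i) t := by
  rw [gexit, gexit, funext (entropyAt_eq_of_mem_symmetryGroup W hπ i t)]

theorem gexitExtra_eq_of_mem_symmetryGroup {p : PMF (Fin N → ℤˣ)} (W : ℝ → BMSChannel)
    {π : Equiv.Perm (Fin N)} (hπ : π ∈ symmetryGroup p) (i j : Fin N) (t : ℝ) :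
    gexitExtra p W i j t = gexitExtra p W (π i) (π j) t := by
  rw [gexitExtra, gexitExtra, funext (entropyAtExtra_eq_of_mem_symmetryGroup W hπ i j t)]

theorem HasDoublyTransitiveSymmetry.integral_gexit_sub_le {p : PMF (Fin N → ℤˣ)}
    (h : HasDoublyTransitiveSymmetry p) {W : ℝ → BMSChannel} (hW : IsACDegradedFamily W)
    {i j : Fin N} (hij : i ≠ j) :
    ∫ t in (0 : ℝ)..1, (gexit p W i t - gexitExtra p W i j t) ≤ 1 / ((N : ℝ) - 1) := by
  have hsum := sum_integral_gexit_sub_le_one p hW j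
  have hconst : ∀ k ∈ Finset.univ.filter (· ≠ j),
      ∫ t in (0 : ℝ)..1, (gexit p W k t - gexitExtra p W k j t) =
        ∫ t in (0 : ℝ)..1, (gexit p W i t - gexitExtra p W i j t) := by
    intro k hk
    -- A symmetry fixing `j` and carrying `k` to `i`: all `N - 1` terms of the sum for this `j` are
    -- equal.
    obtain ⟨π, hπ, h1, h2⟩ := h k j i j (Finset.mem_filter.mp hk).2 hij
    refine intervalIntegral.integral_congr fun t _ => ?_
    rw [gexit_eq_of_mem_symmetryGroup W hπ k, gexitExtra_eq_of_mem_symmetryGroup W hπ k j, h1, h2]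
  have hN : 1 < N := by
    have := Fintype.one_lt_card_iff.mpr ⟨i, j, hij⟩
    simpa using this
  have hN' : (0 : ℝ) < (N : ℝ) - 1 := by
    have : (1 : ℝ) < N := by exact_mod_cast hN
    linarith
  rw [Finset.sum_congr rfl hconst, Finset.sum_const, Finset.filter_ne',
    Finset.card_erase_of_mem (Finset.mem_univ j), Finset.card_univ, Fintype.card_fin,
    nsmul_eq_mul, Nat.cast_sub hN.le, Nat.cast_one] at hsum
  rw [le_div_iff₀ hN']
  linarith

end TwoLooks

theorem mainTheorem6 (W : ℝ → BMSChannel) (hW : IsACDegradedFamily W) (N : ℕ)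
    (p : PMF (Fin N → ℤˣ)) :
    -- the GEXIT functions exist almost everywhere and are integrable on `[0,1]`
    (∀ i : Fin N,
      (∀ᵐ t ∂(MeasureTheory.volume.restrict (Set.Icc (0 : ℝ) 1)),
        DifferentiableWithinAt ℝ (entropyAt p W i t) (Set.Icc 0 1) t) ∧
      IntervalIntegrable (gexit p W i) MeasureTheory.volume 0 1) ∧
    (∀ i j : Fin N, i ≠ j →
      (∀ᵐ t ∂(MeasureTheory.volume.restrict (Set.Icc (0 : ℝ) 1)),
        DifferentiableWithinAt ℝ (entropyAtExtra p W i j t) (Set.Icc 0 1) t) ∧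
      IntervalIntegrable (gexitExtra p W i j) MeasureTheory.volume 0 1) ∧
    -- the bound for every input distribution
    (∑ i : Fin N, ∑ j : Fin N with i ≠ j,
      ∫ t in (0 : ℝ)..1, (gexit p W i t - gexitExtra p W i j t)) ≤ (N : ℝ) ∧
    -- transitive symmetry
    (HasTransitiveSymmetry p →
      ∀ i k : Fin N, ∀ t ∈ Set.Icc (0 : ℝ) 1, gexit p W i t = gexit p W k t) ∧
    -- doubly transitive symmetry
    (HasDoublyTransitiveSymmetry p →
      (∀ i j k l : Fin N, i ≠ j → k ≠ l → ∀ t ∈ Set.Icc (0 : ℝ) 1,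
        gexitExtra p W i j t = gexitExtra p W k l t) ∧
      (∀ i j : Fin N, i ≠ j →
        ∫ t in (0 : ℝ)..1, (gexit p W i t - gexitExtra p W i j t) ≤ 1 / ((N : ℝ) - 1))) := by
  refine ⟨fun i => ⟨ae_differentiableWithinAt_perturbedEntropy p hW id i,
    intervalIntegrable_derivWithin_perturbedEntropy p hW id i⟩,
    fun i j _ => ⟨ae_differentiableWithinAt_perturbedEntropy p hW (extraLook j) (some i),
      intervalIntegrable_derivWithin_perturbedEntropy p hW (extraLook j) (some i)⟩,
    sum_sum_integral_gexit_sub_le p hW, fun h i k t _ => ?_,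
    fun h => ⟨fun i j k l hij hkl t _ => ?_, fun i j hij => h.integral_gexit_sub_le hW hij⟩⟩
  · obtain ⟨π, hπ, rfl⟩ := h i k
    exact gexit_eq_of_mem_symmetryGroup W hπ i t
  · obtain ⟨π, hπ, rfl, rfl⟩ := h i j k l hij hkl
    exact gexitExtra_eq_of_mem_symmetryGroup W hπ i j t
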